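/- Let $d\ge 2$, $\lambda=\frac{d-2}{2}$, let $\mathcal P(\mathbb S^{d-1})$ be the set of Borel probability measures on the unit sphere $\mathbb S^{d-1}\subset\mathbb R^d$, and let $\sigma$ be the normalized surface measure on $\mathbb S^{d-1}$. For $d\ge 3$ let $C_n^\lambda$ be the Gegenbauer polynomials, i.e. $C_0^\lambda=1$, $C_1^\lambda(t)=2\lambda t$ and $nC_n^\lambda(t)=2(n+\lambda-1)\,t\,C_{n-1}^\lambda(t)-(n+2\lambda-2)\,C_{n-2}^\lambda(t)$ for $n\ge2$; for $d=2$ (that is, $\lambda=0$) let $C_n^\lambda$ stand for the Chebyshev polynomial of the first kind $T_n$. Let $\mathcal H_n^d$ be the space of spherical harmonics of order $n$, i.e. of the restrictions to $\mathbb S^{d-1}$ of real homogeneous harmonic polynomials of degree $n$ on $\mathbb R^d$. For a real polynomial $f$ and $\mu\in\mathcal P(\mathbb S^{d-1})$ put $$I_f(\mu)=\int_{\mathbb S^{d-1}}\int_{\mathbb S^{d-1}} f(\langle x,y\rangle)\,d\mu(x)\,d\mu(y),$$ and call $\mu$ a minimizer of $I_f$ if $I_f(\mu)\le I_f(\nu)$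 for all $\nu\in\mathcal P(\mathbb S^{d-1})$. Let $m\ge0$, $a_0,\dots,a_m\in\mathbb R$, and let $f(t)=\sum_{n=0}^m a_n C_n^\lambda(t)$. (i) There exists a discrete minimizer $\mu\in\mathcal P(\mathbb S^{d-1})$ of $I_f$ with $$|\operatorname{supp}\mu|\le 1+\sum_{\substack{1\le n\le m\\ a_n>0}}\dim\mathcal H_n^d .$$ (ii) The measure $\sigma$ is not a minimizer of $I_f$ if and only if $a_n<0$ for some $n$ with $1\le n\le m$. In this case the support of every minimizer of $I_f$ has empty interior in $\mathbb S^{d-1}$ and, if $d=2$, the support of every minimizer is finite. -/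

import Mathlib

open MeasureTheory Polynomial

noncomputable section

/-- The unit sphere `S^{d-1}` of `ℝ^d`. -/
abbrev USphere (d : ℕ) : Type := Metric.sphere (0 : EuclideanSpace ℝ (Fin d)) 1

/-- The Gegenbauer polynomials `C_n^l` in their standard normalization, by the three-term recurrence
`n C_n = 2 (n + l - 1) t C_{n-1} - (n + 2 l - 2) C_{n-2}`, `C_0 = 1`, `C_1 = 2 l t`. -/
def gegenbauer (l : ℝ) : ℕ → ℝ[X]
  | 0 => 1
  | 1 => C (2 * l) * X
  | n + 2 => C ((n + 2 : ℝ)⁻¹) *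
      (C (2 * (n + 1 + l)) * X * gegenbauer l (n + 1) - C (n + 2 * l) * gegenbauer l n)

/-- The polynomials of the ultraspherical expansion on `S^{d-1}`: `C_n^l` with `l = (d - 2) / 2`
when `d ≥ 3`, and the Chebyshev polynomials of the first kind on the circle, where `l = 0`. -/
def sphereGegenbauer (d n : ℕ) : ℝ[X] :=
  if d = 2 then Chebyshev.T ℝ n else gegenbauer (((d : ℝ) - 2) / 2) n

/-- The Laplacian on real polynomials in `d` variables. -/
def polyLaplacian (d : ℕ) : MvPolynomial (Fin d) ℝ →ₗ[ℝ] MvPolynomial (Fin d) ℝ :=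
  ∑ i : Fin d, (MvPolynomial.pderiv i).toLinearMap ∘ₗ (MvPolynomial.pderiv i).toLinearMap

/-- Restriction of a polynomial on `ℝ^d` to the sphere. -/
def restrictToSphere (d : ℕ) : MvPolynomial (Fin d) ℝ →ₗ[ℝ] (USphere d → ℝ) where
  toFun p x := MvPolynomial.eval (fun i => x.1 i) p
  map_add' p q := by ext x; simp
  map_smul' c p := by ext x; simp

/-- The space of spherical harmonics of order `n`: the restrictions to the sphere of the homogeneous
harmonic polynomials of degree `n` on `ℝ^d`. -/
def sphericalHarmonics (d n : ℕ) : Submodule ℝ (USphere d → ℝ) :=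
  (MvPolynomial.homogeneousSubmodule (Fin d) ℝ n ⊓ LinearMap.ker (polyLaplacian d)).map
    (restrictToSphere d)

/-- The energy `I_f(μ) = ∫∫ f(⟨x, y⟩) dμ(x) dμ(y)`. -/
def energy {d : ℕ} (f : ℝ → ℝ) (μ : Measure (USphere d)) : ℝ :=
  ∫ x : USphere d, ∫ y : USphere d,
    f (inner ℝ (x : EuclideanSpace ℝ (Fin d)) (y : EuclideanSpace ℝ (Fin d))) ∂μ ∂μ

/-- `μ` minimizes `I_f` over the Borel probability measures on the sphere. -/
def IsEnergyMinimizer {d : ℕ} (f : ℝ → ℝ) (μ : Measure (USphere d)) : Prop :=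
  IsProbabilityMeasure μ ∧
    ∀ ν : Measure (USphere d), IsProbabilityMeasure ν → energy f μ ≤ energy f ν

/-- The normalized surface measure `σ` on the sphere. -/
def uniformMeasure (d : ℕ) : Measure (USphere d) :=
  ((volume : Measure (EuclideanSpace ℝ (Fin d))).toSphere Set.univ)⁻¹ •
    (volume : Measure (EuclideanSpace ℝ (Fin d))).toSphere

theorem isProbabilityMeasure_uniformMeasure (d : ℕ) (hd : 1 ≤ d) :
    IsProbabilityMeasure (uniformMeasure d) := by
  constructor
  have : Nontrivial (EuclideanSpace ℝ (Fin d)) := by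
    have : NeZero d := ⟨by omega⟩
    infer_instance
  rw [uniformMeasure, Measure.smul_apply, smul_eq_mul]
  refine ENNReal.inv_mul_cancel ?_ (measure_ne_top _ _)
  have : Nonempty (USphere d) := (NormedSpace.sphere_nonempty.2 zero_le_one).to_subtype
  exact isOpen_univ.measure_ne_zero _ Set.univ_nonempty

end

/-! By the addition formula, `C_n(⟨x, y⟩) = ∑ φ_j(x) φ_j(y)` with spherical harmonics `φ_j` of order
`n`, so the energy is `∑_n a_n ∑_j (∫ φ_{n,j} dμ)²`: a diagonal quadratic form in finitely many
moments, whose order 0 part is the constant `a_0`. The formula (`exists_addition_formula`) is proved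
algebraically: the homogenized `C_n` is harmonic and represents, up to a positive factor, evaluation
at `y` in the Fischer inner product.

(i) Moment vectors of probability measures lie in the convex hull of a compact set, which is compact
and whose points are realized by finitely many atoms; this gives a discrete minimizer. If it has
more atoms than the claimed bound, some nonzero signed weights on the atoms have zero mass and zero
moments in every order `n ≥ 1` with `a_n > 0`. The energy is concave along them, so moving in a
suitable direction until a weight vanishes removes an atom without raising the energy.

(ii) Harmonics of different orders are orthogonal (`integral_mul_sphericalHarmonics`), because they
belong to different eigenvalues of the spherical Laplacian, a sum of squares of rotation fields.
Hence `σ` has energy `a_0`. This is minimal if no `a_n` with `n ≥ 1` is negative; otherwise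
perturbing `σ` by a harmonic of an order with `a_n < 0` lowers the energy. The potential of a
minimizer `μ` equals its energy on the support, and it is the restriction of a polynomial. Were it
constant on the sphere, averaging against `σ` would show that `σ` has the energy of `μ`. So if `σ`
is not minimal, the support lies in a proper polynomial zero set, which has empty interior, and is
finite on the circle, by analyticity along great circles. -/

open MvPolynomial in
theorem polyLaplacian_apply (d : ℕ) (p : MvPolynomial (Fin d) ℝ) :
    polyLaplacian d p = ∑ i, pderiv i (pderiv i p) := by
  simp [polyLaplacian]

/-! ### Zonal polynomials and the Fischer inner product. -/

namespace MvPolynomial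


variable {d : ℕ}

theorem polyLaplacian_mul (p q : MvPolynomial (Fin d) ℝ) :
    polyLaplacian d (p * q) =
      polyLaplacian d p * q + 2 * ∑ i, pderiv i p * pderiv i q + p * polyLaplacian d q := by
  simp only [polyLaplacian_apply, pderiv_mul, map_add, Finset.sum_add_distrib, Finset.sum_mul,
    Finset.mul_sum]
  rw [show ∀ a b c e : MvPolynomial (Fin d) ℝ, a + b + (c + e) = a + (b + c) + e by intros; ring,
    ← Finset.sum_add_distrib]
  congr 2
  exact Finset.sum_congr rfl fun i _ => by ring

/-- The linear form `x ↦ ⟨x, y⟩`. -/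
noncomputable def linForm (y : Fin d → ℝ) : MvPolynomial (Fin d) ℝ := ∑ i, C (y i) * X i

/-- The square of the Euclidean norm. -/
noncomputable def normSqPoly (d : ℕ) : MvPolynomial (Fin d) ℝ := ∑ i, X i ^ 2

/-- The derivative in the direction of `y`. -/
noncomputable def dirDeriv (y : Fin d → ℝ) (p : MvPolynomial (Fin d) ℝ) : MvPolynomial (Fin d) ℝ :=
  ∑ i, C (y i) * pderiv i p

theorem pderiv_linForm (y : Fin d → ℝ) (i : Fin d) : pderiv i (linForm y) = C (y i) := by
  simp [linForm, pderiv_X, Pi.single_apply]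

theorem pderiv_normSqPoly (i : Fin d) : pderiv i (normSqPoly d) = 2 * X i := by
  simp [normSqPoly, pderiv_X, Pi.single_apply]

theorem polyLaplacian_linForm (y : Fin d → ℝ) : polyLaplacian d (linForm y) = 0 := by
  simp [polyLaplacian_apply, pderiv_linForm]

theorem polyLaplacian_normSqPoly :
    polyLaplacian d (normSqPoly d) = 2 * (d : MvPolynomial (Fin d) ℝ) := by
  have h (i : Fin d) : pderiv i (2 : MvPolynomial (Fin d) ℝ) = 0 := by
    rw [← map_ofNat (C (R := ℝ) (σ := Fin d)) 2, pderiv_C]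
  simp [polyLaplacian_apply, pderiv_normSqPoly, h, mul_comm]

theorem dirDeriv_mul (y : Fin d → ℝ) (p q : MvPolynomial (Fin d) ℝ) :
    dirDeriv y (p * q) = dirDeriv y p * q + p * dirDeriv y q := by
  simp only [dirDeriv, pderiv_mul, Finset.sum_mul, Finset.mul_sum, ← Finset.sum_add_distrib]
  exact Finset.sum_congr rfl fun i _ => by ring

theorem dirDeriv_sub (y : Fin d → ℝ) (p q : MvPolynomial (Fin d) ℝ) :
    dirDeriv y (p - q) = dirDeriv y p - dirDeriv y q := by
  simp [dirDeriv, mul_sub]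

theorem dirDeriv_C (y : Fin d → ℝ) (a : ℝ) : dirDeriv y (C a) = 0 := by
  simp [dirDeriv]

theorem dirDeriv_linForm (y : Fin d → ℝ) : dirDeriv y (linForm y) = C (∑ i, y i ^ 2) := by
  simp [dirDeriv, pderiv_linForm, sq]

theorem dirDeriv_normSqPoly (y : Fin d → ℝ) : dirDeriv y (normSqPoly d) = 2 * linForm y := by
  simp only [dirDeriv, pderiv_normSqPoly, linForm, Finset.mul_sum]
  exact Finset.sum_congr rfl fun i _ => by ring

theorem polyLaplacian_linForm_mul (y : Fin d → ℝ) (p : MvPolynomial (Fin d) ℝ) :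
    polyLaplacian d (linForm y * p) = 2 * dirDeriv y p + linForm y * polyLaplacian d p := by
  simp [polyLaplacian_mul, polyLaplacian_linForm, pderiv_linForm, dirDeriv]

theorem polyLaplacian_normSqPoly_mul {n : ℕ} {p : MvPolynomial (Fin d) ℝ} (hp : p.IsHomogeneous n) :
    polyLaplacian d (normSqPoly d * p) =
      C (2 * d + 4 * n : ℝ) * p + normSqPoly d * polyLaplacian d p := by
  have h := hp.sum_X_mul_pderiv
  simp only [polyLaplacian_mul, polyLaplacian_normSqPoly, pderiv_normSqPoly, mul_assoc,
    ← Finset.mul_sum, h, map_add, map_mul, map_natCast, nsmul_eq_mul, map_ofNat]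
  ring

theorem isHomogeneous_linForm (y : Fin d → ℝ) : (linForm y).IsHomogeneous 1 :=
  IsHomogeneous.sum _ _ _ fun i _ => by
    simpa using (isHomogeneous_C (Fin d) (y i)).mul (isHomogeneous_X ℝ i)

theorem isHomogeneous_normSqPoly : (normSqPoly d).IsHomogeneous 2 :=
  IsHomogeneous.sum _ _ _ fun i _ => isHomogeneous_X_pow i 2

/-- The homogenization of the polynomials `C_0 = 1`, `C_1 = c t`,
`C_{n+2} = α n t C_{n+1} - β n C_n` in the variable `t = ⟨x, y⟩`. -/
noncomputable def zonalPoly (c : ℝ) (α β : ℕ → ℝ) (y : Fin d → ℝ) : ℕ → MvPolynomial (Fin d) ℝ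
  | 0 => 1
  | 1 => C c * linForm y
  | n + 2 => C (α n) * (linForm y * zonalPoly c α β y (n + 1)) -
      C (β n) * (normSqPoly d * zonalPoly c α β y n)

theorem zonalPoly_add_two (c : ℝ) (α β : ℕ → ℝ) (y : Fin d → ℝ) (n : ℕ) :
    zonalPoly c α β y (n + 2) = C (α n) * (linForm y * zonalPoly c α β y (n + 1)) -
      C (β n) * (normSqPoly d * zonalPoly c α β y n) := by
  rw [zonalPoly]

theorem isHomogeneous_zonalPoly (c : ℝ) (α β : ℕ → ℝ) (y : Fin d → ℝ) :
    ∀ n, (zonalPoly c α β y n).IsHomogeneous n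
  | 0 => isHomogeneous_one _ _
  | 1 => by
    simpa [zonalPoly] using (isHomogeneous_C (Fin d) c).mul (isHomogeneous_linForm y)
  | n + 2 => by
    rw [zonalPoly]
    have h1 := (isHomogeneous_C (Fin d) (α n)).mul
      ((isHomogeneous_linForm y).mul (isHomogeneous_zonalPoly c α β y (n + 1)))
    have h2 := (isHomogeneous_C (Fin d) (β n)).mul
      (isHomogeneous_normSqPoly.mul (isHomogeneous_zonalPoly c α β y n))
    rw [show 0 + (1 + (n + 1)) = n + 2 by ring] at h1
    rw [show 0 + (2 + n) = n + 2 by ring] at h2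
    exact h1.sub h2

/-- The hypotheses are what comparison of coefficients requires when the recurrence is
differentiated along `y`: `hα` matches the terms in `linForm y`, `hβ` those in `normSqPoly d`. The
start is separate because `zonalPoly` of order 1 is not given by the recurrence. -/
theorem dirDeriv_zonalPoly {c : ℝ} {α β γ : ℕ → ℝ} {y : Fin d → ℝ} (hy : ∑ i, y i ^ 2 = 1)
    (h0 : γ 0 = c) (h1 : 2 * α 0 * c - 2 * β 0 = γ 1 * c)
    (hα : ∀ n, α (n + 1) * γ (n + 1) - 2 * β (n + 1) = (γ (n + 2) - α (n + 1)) * α n)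
    (hβ : ∀ n, β (n + 1) * γ n = (γ (n + 2) - α (n + 1)) * β n) :
    ∀ n, dirDeriv y (zonalPoly c α β y (n + 1)) = C (γ n) * zonalPoly c α β y n
  | 0 => by simp [zonalPoly, dirDeriv_mul, dirDeriv_C, dirDeriv_linForm, hy, h0]
  | 1 => by
    have h1' := congrArg (C (σ := Fin d)) h1
    simp only [map_sub, map_mul, map_ofNat] at h1'
    rw [show 1 + 1 = 0 + 2 from rfl, zonalPoly_add_two, dirDeriv_sub, dirDeriv_mul, dirDeriv_mul,
      dirDeriv_mul, dirDeriv_mul, dirDeriv_zonalPoly hy h0 h1 hα hβ 0, dirDeriv_C, dirDeriv_C,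
      dirDeriv_linForm, hy, h0, dirDeriv_normSqPoly]
    simp only [zonalPoly, ← C_1, dirDeriv_C]
    simp only [C_1]
    linear_combination linForm y * h1'
  | n + 2 => by
    have hα' := congrArg (C (σ := Fin d)) (hα n)
    have hβ' := congrArg (C (σ := Fin d)) (hβ n)
    simp only [map_sub, map_mul, map_ofNat] at hα' hβ'
    rw [zonalPoly_add_two, dirDeriv_sub, dirDeriv_mul, dirDeriv_mul, dirDeriv_mul, dirDeriv_mul,
      dirDeriv_zonalPoly hy h0 h1 hα hβ (n + 1), dirDeriv_zonalPoly hy h0 h1 hα hβ n,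
      dirDeriv_C, dirDeriv_C, dirDeriv_linForm, hy, dirDeriv_normSqPoly]
    rw [zonalPoly_add_two c α β y n, C_1]
    linear_combination linForm y * zonalPoly c α β y (n + 1) * hα' -
      normSqPoly d * zonalPoly c α β y n * hβ'

/-- Once the lower orders are harmonic, the Laplacian of order `n + 2` is `2 (α n γ n - β n (d + 2
n))` times order `n`, and `hd` makes the factor vanish. -/
theorem polyLaplacian_zonalPoly {c : ℝ} {α β γ : ℕ → ℝ} {y : Fin d → ℝ} (hy : ∑ i, y i ^ 2 = 1)
    (h0 : γ 0 = c) (h1 : 2 * α 0 * c - 2 * β 0 = γ 1 * c)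
    (hα : ∀ n, α (n + 1) * γ (n + 1) - 2 * β (n + 1) = (γ (n + 2) - α (n + 1)) * α n)
    (hβ : ∀ n, β (n + 1) * γ n = (γ (n + 2) - α (n + 1)) * β n)
    (hd : ∀ n, α n * γ n = β n * (d + 2 * n)) :
    ∀ n, polyLaplacian d (zonalPoly c α β y n) = 0
  | 0 => by simp [zonalPoly, polyLaplacian_apply]
  | 1 => by
    rw [zonalPoly, ← smul_eq_C_mul, map_smul, polyLaplacian_linForm, smul_zero]
  | n + 2 => by
    have hd' := congrArg (C (σ := Fin d)) (hd n)
    rw [zonalPoly_add_two, map_sub, ← smul_eq_C_mul, map_smul, ← smul_eq_C_mul, map_smul,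
      polyLaplacian_linForm_mul, polyLaplacian_normSqPoly_mul (isHomogeneous_zonalPoly c α β y n),
      polyLaplacian_zonalPoly hy h0 h1 hα hβ hd (n + 1),
      polyLaplacian_zonalPoly hy h0 h1 hα hβ hd n, dirDeriv_zonalPoly hy h0 h1 hα hβ n]
    simp only [smul_eq_C_mul, map_add, map_mul, map_natCast, map_ofNat] at hd' ⊢
    linear_combination 2 * zonalPoly c α β y n * hd'

/-- Multiples of the squared norm are Fischer orthogonal to harmonic polynomials, so only the power
of the linear form matters there. It is essential that `κ` does not depend on `y`. -/
theorem exists_zonalPoly_eq {c : ℝ} {α : ℕ → ℝ} (β : ℕ → ℝ) (hc : 0 < c) (hα : ∀ n, 0 < α n)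
    (n : ℕ) : ∃ κ : ℝ, 0 < κ ∧ ∀ y : Fin d → ℝ, ∃ q,
      zonalPoly c α β y n = C κ * linForm y ^ n + normSqPoly d * q := by
  rcases n with _ | n
  · exact ⟨1, one_pos, fun y => ⟨0, by simp [zonalPoly]⟩⟩
  induction n with
  | zero => exact ⟨c, hc, fun y => ⟨0, by simp [zonalPoly]⟩⟩
  | succ n ih =>
    obtain ⟨κ, hκ, h⟩ := ih
    refine ⟨α n * κ, mul_pos (hα n) hκ, fun y => ?_⟩
    obtain ⟨q, hq⟩ := h y
    refine ⟨C (α n) * linForm y * q - C (β n) * zonalPoly c α β y n, ?_⟩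
    rw [zonalPoly_add_two, hq, C_mul]
    ring

theorem eval_linForm (x y : Fin d → ℝ) : eval x (linForm y) = ∑ i, y i * x i := by
  simp [linForm]

theorem eval_normSqPoly (x : Fin d → ℝ) : eval x (normSqPoly d) = ∑ i, x i ^ 2 := by
  simp [normSqPoly]

theorem eval_zonalPoly {c : ℝ} {α β : ℕ → ℝ} {x y : Fin d → ℝ} (hx : ∑ i, x i ^ 2 = 1)
    {F : ℕ → ℝ} (h0 : F 0 = 1) (h1 : F 1 = c * ∑ i, y i * x i)
    (h2 : ∀ n, F (n + 2) = α n * (∑ i, y i * x i) * F (n + 1) - β n * F n) :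
    ∀ n, eval x (zonalPoly c α β y n) = F n
  | 0 => by simp [zonalPoly, h0]
  | 1 => by simp [zonalPoly, h1, eval_linForm]
  | n + 2 => by
    rw [zonalPoly_add_two]
    simp only [eval_sub, eval_mul, eval_C, eval_linForm, eval_normSqPoly, hx, h2,
      eval_zonalPoly hx h0 h1 h2 (n + 1), eval_zonalPoly hx h0 h1 h2 n]
    ring

/-- The Fischer inner product, for which multiplication by `X i` is adjoint to `∂/∂X i`. -/
noncomputable def fischer (d : ℕ) : LinearMap.BilinForm ℝ (MvPolynomial (Fin d) ℝ) :=
  (basisMonomials (Fin d) ℝ).constr ℝ fun m => ((∏ i, (m i).factorial : ℕ) : ℝ) • lcoeff ℝ m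

theorem fischer_monomial (m : Fin d →₀ ℕ) (a : ℝ) (q : MvPolynomial (Fin d) ℝ) :
    fischer d (monomial m a) q = a * ((∏ i, (m i).factorial : ℕ) * coeff m q) := by
  have h : fischer d (monomial m 1) = ((∏ i, (m i).factorial : ℕ) : ℝ) • lcoeff ℝ m := by
    simpa [fischer] using (basisMonomials (Fin d) ℝ).constr_basis ℝ
      (fun m => ((∏ i, (m i).factorial : ℕ) : ℝ) • lcoeff ℝ m) m
  have h' : monomial m a = a • (monomial m 1 : MvPolynomial (Fin d) ℝ) := by simp [smul_monomial]
  rw [h', map_smul, LinearMap.smul_apply, h]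
  simp [lcoeff]

theorem fischer_apply (p q : MvPolynomial (Fin d) ℝ) :
    fischer d p q = ∑ m ∈ p.support, coeff m p * ((∏ i, (m i).factorial : ℕ) * coeff m q) := by
  conv_lhs => rw [p.as_sum]
  simp only [map_sum, LinearMap.sum_apply, fischer_monomial]

theorem fischer_comm (p q : MvPolynomial (Fin d) ℝ) : fischer d p q = fischer d q p := by
  have key (p q : MvPolynomial (Fin d) ℝ) : fischer d p q = ∑ m ∈ p.support ∪ q.support,
      coeff m p * ((∏ i, (m i).factorial : ℕ) * coeff m q) := by
    rw [fischer_apply]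
    refine Finset.sum_subset Finset.subset_union_left fun m _ hm => ?_
    rw [notMem_support_iff.1 hm, zero_mul]
  rw [key p q, key q p, Finset.union_comm]
  exact Finset.sum_congr rfl fun m _ => by ring

theorem fischer_self_pos {p : MvPolynomial (Fin d) ℝ} (hp : p ≠ 0) : 0 < fischer d p p := by
  rw [fischer_apply]
  refine Finset.sum_pos (fun m hm => ?_) (support_nonempty.2 hp)
  have h1 : coeff m p ≠ 0 := mem_support_iff.1 hm
  have h2 : (0 : ℝ) < (∏ i, (m i).factorial : ℕ) := by
    exact_mod_cast Finset.prod_pos fun i _ => Nat.factorial_pos _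
  have h3 := mul_pos h2 (mul_self_pos.2 h1)
  linarith

theorem fischer_X_mul (i : Fin d) (p q : MvPolynomial (Fin d) ℝ) :
    fischer d (X i * p) q = fischer d p (pderiv i q) := by
  induction p using MvPolynomial.induction_on' with
  | monomial m a =>
    have h : X i * monomial m a = monomial (m + Finsupp.single i 1) a := by
      rw [X, monomial_mul, one_mul, add_comm]
    have h' : ∏ j, ((m + Finsupp.single i 1 : Fin d →₀ ℕ) j).factorial =
        (m i + 1) * ∏ j, (m j).factorial := by
      rw [← Finset.mul_prod_erase _ _ (Finset.mem_univ i),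
        ← Finset.mul_prod_erase (Finset.univ : Finset (Fin d)) (fun j => (m j).factorial)
          (Finset.mem_univ i), ← mul_assoc]
      congr 1
      · simp [Nat.factorial_succ]
      · refine Finset.prod_congr rfl fun j hj => ?_
        simp [Finsupp.single_eq_of_ne (Finset.ne_of_mem_erase hj)]
    rw [h, fischer_monomial, fischer_monomial, coeff_pderiv, h']
    push_cast
    ring
  | add p q hp hq => simp only [mul_add, map_add, LinearMap.add_apply, hp, hq]

theorem fischer_normSqPoly_mul (p q : MvPolynomial (Fin d) ℝ) :
    fischer d (normSqPoly d * p) q = fischer d p (polyLaplacian d q) := by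
  simp [normSqPoly, Finset.sum_mul, sq, mul_assoc, fischer_X_mul, polyLaplacian_apply]

/-- Induction on the degree: Euler's identity writes `(n + 1) p` as `∑ X i * ∂_i p`, and moving `X
i` to the other side differentiates the power of the linear form. -/
theorem fischer_linForm_pow (y : Fin d → ℝ) (n : ℕ) {p : MvPolynomial (Fin d) ℝ}
    (hp : p.IsHomogeneous n) : fischer d p (linForm y ^ n) = n.factorial * eval y p := by
  induction n generalizing p with
  | zero =>
    obtain ⟨a, rfl⟩ : ∃ a, p = C a := ⟨_, totalDegree_eq_zero_iff_eq_C.1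
      (Nat.le_zero.1 hp.totalDegree_le)⟩
    rw [C_apply, fischer_monomial]
    simp
  | succ n ih =>
    have h1 := hp.sum_X_mul_pderiv
    rw [← Nat.cast_smul_eq_nsmul ℝ] at h1
    have h2 (i : Fin d) : fischer d (X i * pderiv i p) (linForm y ^ (n + 1)) =
        (n + 1) * n.factorial * (y i * eval y (pderiv i p)) := by
      have h3 : pderiv i (linForm y ^ (n + 1)) = ((n + 1) * y i) • linForm y ^ n := by
        rw [pderiv_pow, pderiv_linForm, smul_eq_C_mul]
        simp
        ring
      rw [fischer_X_mul, h3, map_smul, ih hp.pderiv, smul_eq_mul]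
      ring
    have h4 := congrArg (fun r => fischer d r (linForm y ^ (n + 1))) h1
    have h5 := congrArg (eval y) h1
    simp only [map_sum, LinearMap.sum_apply, h2, ← Finset.mul_sum, map_smul, LinearMap.smul_apply,
      eval_mul, eval_X, smul_eval, smul_eq_mul] at h4 h5
    rw [h5] at h4
    have h6 : ((n + 1 : ℕ) : ℝ) ≠ 0 := by positivity
    rw [Nat.factorial_succ]
    apply mul_left_cancel₀ h6
    rw [← h4]
    push_cast
    ring
end MvPolynomial

/-! ### The addition formula. -/

/-- Treats the circle and higher dimensions uniformly; the circle needs its own constants, since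
`gegenbauer 0` is zero in order 1. The numbers `γ n` are the factors by which the derivative along
`y` takes order `n + 1` to order `n`: `n + 1` on the circle and `n + d - 2` otherwise. -/
theorem exists_sphereGegenbauer_recurrence {d : ℕ} (hd : 2 ≤ d) :
    ∃ (c : ℝ) (α β γ : ℕ → ℝ), 0 < c ∧ (∀ n, 0 < α n) ∧
      γ 0 = c ∧ 2 * α 0 * c - 2 * β 0 = γ 1 * c ∧
      (∀ n, α (n + 1) * γ (n + 1) - 2 * β (n + 1) = (γ (n + 2) - α (n + 1)) * α n) ∧
      (∀ n, β (n + 1) * γ n = (γ (n + 2) - α (n + 1)) * β n) ∧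
      (∀ n, α n * γ n = β n * (d + 2 * n)) ∧
      ∀ t : ℝ, (sphereGegenbauer d 0).eval t = 1 ∧ (sphereGegenbauer d 1).eval t = c * t ∧
        ∀ n, (sphereGegenbauer d (n + 2)).eval t =
          α n * t * (sphereGegenbauer d (n + 1)).eval t - β n * (sphereGegenbauer d n).eval t := by
  rcases hd.eq_or_lt with rfl | hd
  · refine ⟨1, fun _ => 2, fun _ => 1, fun n => n + 1, one_pos, fun _ => two_pos, by simp,
      by norm_num, fun n => by push_cast; ring, fun n => by push_cast; ring,
      fun n => by push_cast; ring, fun t => ⟨by simp [sphereGegenbauer],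
        by simp [sphereGegenbauer], fun n => ?_⟩⟩
    simp [sphereGegenbauer, Polynomial.Chebyshev.T_add_two]
  · have hd2 : d ≠ 2 := by omega
    have hd' : (3 : ℝ) ≤ d := by exact_mod_cast hd
    have h1 (n : ℕ) : (n : ℝ) + 2 ≠ 0 := by positivity
    have h2 (n : ℕ) : (n : ℝ) + 1 + 2 ≠ 0 := by positivity
    refine ⟨d - 2, fun n => 2 * (n + 1 + (d - 2) / 2) / (n + 2), fun n => (n + (d - 2)) / (n + 2),
      fun n => n + (d - 2), by linarith, fun n => ?_, by simp, ?_, fun n => ?_, fun n => ?_,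
      fun n => ?_, fun t => ⟨by simp [sphereGegenbauer, hd2, gegenbauer],
        by simp [sphereGegenbauer, hd2, gegenbauer, mul_div_cancel₀], fun n => ?_⟩⟩
    · have : (0 : ℝ) ≤ n := n.cast_nonneg
      apply div_pos <;> linarith
    · push_cast; field_simp; ring
    · have := h1 n; have := h2 n; push_cast; field_simp; ring
    · have := h1 n; have := h2 n; push_cast; field_simp; ring
    · have := h1 n; field_simp; ring
    · have := h1 n
      simp only [sphereGegenbauer, hd2, if_false, gegenbauer]
      simp only [Polynomial.eval_mul, Polynomial.eval_sub, Polynomial.eval_C, Polynomial.eval_X]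
      field_simp

-- The last clause is a reproducing property. It holds since `Z` is a multiple of the `n`-th power
-- of `⟨x, y⟩` modulo the squared norm, whose adjoint, the Laplacian, kills `p`.
open MvPolynomial in
theorem exists_zonal_harmonic {d : ℕ} (hd : 2 ≤ d) (n : ℕ) :
    ∃ κ : ℝ, 0 < κ ∧ ∀ y : Fin d → ℝ, ∑ i, y i ^ 2 = 1 → ∃ Z : MvPolynomial (Fin d) ℝ,
      Z.IsHomogeneous n ∧ polyLaplacian d Z = 0 ∧
      (∀ x : Fin d → ℝ, ∑ i, x i ^ 2 = 1 →
        eval x Z = (sphereGegenbauer d n).eval (∑ i, y i * x i)) ∧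
      ∀ p : MvPolynomial (Fin d) ℝ, p.IsHomogeneous n → polyLaplacian d p = 0 →
        fischer d p Z = κ * eval y p := by
  obtain ⟨c, α, β, γ, hc, hα, h0, h1, h2, h3, h4, h5⟩ := exists_sphereGegenbauer_recurrence hd
  obtain ⟨κ, hκ, hZ⟩ := exists_zonalPoly_eq (d := d) β hc hα n
  refine ⟨κ * n.factorial, by positivity, fun y hy => ⟨zonalPoly c α β y n,
    isHomogeneous_zonalPoly c α β y n, polyLaplacian_zonalPoly hy h0 h1 h2 h3 h4 n,
    fun x hx => ?_, fun p hp hp' => ?_⟩⟩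
  · exact eval_zonalPoly hx (F := fun k => (sphereGegenbauer d k).eval (∑ i, y i * x i))
      (h5 _).1 (h5 _).2.1 (h5 _).2.2 n
  · obtain ⟨q, hq⟩ := hZ y
    rw [hq, map_add, ← MvPolynomial.smul_eq_C_mul, map_smul, fischer_linForm_pow y n hp,
      fischer_comm p, fischer_normSqPoly_mul, hp', map_zero, smul_eq_mul]
    ring

theorem USphere.sum_sq {d : ℕ} (x : USphere d) : ∑ i, x.1 i ^ 2 = 1 := by
  have h : ‖x.1‖ = 1 := by simp
  have := EuclideanSpace.real_norm_sq_eq x.1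
  rw [← this, h, one_pow]

open MvPolynomial in
/-- The addition formula for spherical harmonics. -/
theorem exists_addition_formula {d : ℕ} (hd : 2 ≤ d) (n : ℕ) :
    ∃ (N : ℕ) (φ : Fin N → USphere d → ℝ), (∀ j, φ j ∈ sphericalHarmonics d n) ∧
      ∀ x y : USphere d, (sphereGegenbauer d n).eval (inner ℝ x.1 y.1) =
        ∑ j, φ j x * φ j y := by
  obtain ⟨κ, hκ, hZ⟩ := exists_zonal_harmonic hd n
  set W := homogeneousSubmodule (Fin d) ℝ n ⊓ LinearMap.ker (polyLaplacian d)
  have : Module.Finite ℝ (homogeneousSubmodule (Fin d) ℝ n) :=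
    Module.Finite.iff_fg.2 (homogeneousSubmodule_fg _ _ n)
  have hWfin : Module.Finite ℝ W := Submodule.finiteDimensional_inf_left _ _
  have hsymm : LinearMap.IsSymm (LinearMap.BilinForm.restrict (fischer d) W) :=
    ⟨fun p q => fischer_comm _ _⟩
  obtain ⟨v, hv⟩ := LinearMap.BilinForm.exists_orthogonal_basis hsymm
  have hpos (j) : 0 < fischer d (v j) (v j) := 
    fischer_self_pos fun h => v.ne_zero j (Subtype.ext h)
  -- A reproducing kernel is the sum of `v j ⊗ v j` over an orthogonal basis, each divided by the
  -- squared length. The square root distributes this factor and `κ` evenly over the two variables.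
  refine ⟨_, fun j => √(κ / fischer d (v j) (v j)) • restrictToSphere d (v j), fun j =>
    Submodule.smul_mem _ _ (Submodule.mem_map_of_mem (v j).2), fun x y => ?_⟩
  obtain ⟨Z, hZ1, hZ2, hZ3, hZ4⟩ := hZ (fun i => y.1 i) y.sum_sq
  let z : W := ⟨Z, hZ1, hZ2⟩
  have h : Z = ∑ j, v.repr z j • (v j : MvPolynomial (Fin d) ℝ) := by
    conv_lhs => rw [show Z = W.subtype z from rfl, ← v.sum_repr z, map_sum]
    simp
  have hrepr (k) : v.repr z k = κ * eval (fun i => y.1 i) (v k : MvPolynomial (Fin d) ℝ) /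
      fischer d (v k) (v k) := by
    rw [eq_div_iff (hpos k).ne', ← hZ4 _ (v k).2.1 (v k).2.2]
    conv_rhs => rw [h]
    rw [map_sum, Finset.sum_eq_single k]
    · simp
    · intro j _ hj
      have : fischer d (v k) (v j) = 0 := hv hj.symm
      rw [map_smul, this, smul_zero]
    · simp
  have hxy : inner ℝ x.1 y.1 = ∑ i, y.1 i * x.1 i := by
    simp [PiLp.inner_apply]
  rw [hxy, ← hZ3 _ x.sum_sq, h, map_sum]
  refine Finset.sum_congr rfl fun j _ => ?_
  have h1 : √(κ / fischer d (v j) (v j)) * √(κ / fischer d (v j) (v j)) =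
    κ / fischer d (v j) (v j) := Real.mul_self_sqrt (div_pos hκ (hpos j)).le
  simp only [Pi.smul_apply, smul_eq_mul, MvPolynomial.smul_eval, hrepr, restrictToSphere,
    LinearMap.coe_mk, AddHom.coe_mk]
  rw [mul_mul_mul_comm, h1]
  ring

instance finite_sphericalHarmonics (d n : ℕ) : Module.Finite ℝ (sphericalHarmonics d n) := by
  have : Module.Finite ℝ (MvPolynomial.homogeneousSubmodule (Fin d) ℝ n) :=
    Module.Finite.iff_fg.2 (MvPolynomial.homogeneousSubmodule_fg _ _ n)
  have : Module.Finite ℝ (MvPolynomial.homogeneousSubmodule (Fin d) ℝ n ⊓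
    LinearMap.ker (polyLaplacian d) : Submodule ℝ _) := Submodule.finiteDimensional_inf_left _ _
  exact Module.Finite.map _ _

/-! ### Rotation fields and the spherical Laplacian. -/

namespace MvPolynomial

variable {d : ℕ}

/-- The vector field `x_i ∂_j - x_j ∂_i` generating the rotations of the `(i, j)`-plane. -/
noncomputable def rotDeriv (i j : Fin d) (p : MvPolynomial (Fin d) ℝ) : MvPolynomial (Fin d) ℝ :=
  X i * pderiv j p - X j * pderiv i p

theorem rotDeriv_mul (i j : Fin d) (p q : MvPolynomial (Fin d) ℝ) :
    rotDeriv i j (p * q) = rotDeriv i j p * q + p * rotDeriv i j q := by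
  simp only [rotDeriv, pderiv_mul]
  ring

/-- The squares of the rotation fields add up to the spherical Laplacian. -/
theorem sum_rotDeriv_rotDeriv {n : ℕ} {p : MvPolynomial (Fin d) ℝ} (hp : p.IsHomogeneous n) :
    ∑ i, ∑ j, rotDeriv i j (rotDeriv i j p) =
      2 * (normSqPoly d * polyLaplacian d p) - C (2 * n * (n + d - 2) : ℝ) * p := by
  have euler : ∑ i, X i * pderiv i p = C (n : ℝ) * p := by
    rw [hp.sum_X_mul_pderiv, nsmul_eq_mul, map_natCast]
  have h1 : ∑ i, ∑ j, X i * X j * pderiv j (pderiv i p) = C (n * (n - 1) : ℝ) * p := by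
    rw [Finset.sum_comm]
    -- This is Euler's identity differentiated in `X j` and multiplied by `X j`.
    have h (j : Fin d) : ∑ i, X i * X j * pderiv j (pderiv i p) =
        C (n - 1 : ℝ) * (X j * pderiv j p) := by
      have h' := congrArg (pderiv j) euler
      simp only [map_sum, pderiv_mul, pderiv_X, Finset.sum_add_distrib, pderiv_C, zero_mul,
        zero_add, Pi.single_apply, ite_mul, one_mul, Finset.sum_ite_eq', Finset.mem_univ,
        if_true] at h'
      rw [C_sub, C_1]
      have : ∑ i, X i * X j * pderiv j (pderiv i p) = X j * ∑ i, X i * pderiv j (pderiv i p) := by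
        rw [Finset.mul_sum]
        exact Finset.sum_congr rfl fun i _ => by ring
      rw [this]
      linear_combination X j * h'
    rw [Finset.sum_congr rfl fun j _ => h j, ← Finset.mul_sum, euler, ← mul_assoc, ← C_mul,
      mul_comm (n : ℝ)]
  have h2 : ∑ i, ∑ j, X i * X j * pderiv i (pderiv j p) = C (n * (n - 1) : ℝ) * p := by
    rw [← h1, Finset.sum_comm]
    exact Finset.sum_congr rfl fun i _ => Finset.sum_congr rfl fun j _ => by ring
  have h3 : ∑ i, ∑ j, X i ^ 2 * pderiv j (pderiv j p) = normSqPoly d * polyLaplacian d p := by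
    rw [normSqPoly, polyLaplacian_apply, Finset.sum_mul_sum]
  have h4 : ∑ i, ∑ j, X j ^ 2 * pderiv i (pderiv i p) = normSqPoly d * polyLaplacian d p := by
    rw [← h3, Finset.sum_comm]
  have h5 : ∑ i : Fin d, ∑ _j : Fin d, X i * pderiv i p = C (d * n : ℝ) * p := by
    simp [Finset.sum_const, ← Finset.mul_sum, euler, mul_assoc]
  have h6 : ∑ _i : Fin d, ∑ j : Fin d, X j * pderiv j p = C (d * n : ℝ) * p := by
    simp [Finset.sum_const, euler, mul_assoc]
  have h7 : ∑ i : Fin d, ∑ j : Fin d, (if j = i then X i * pderiv j p else 0) = C (n : ℝ) * p := by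
    simp [euler]
  have h8 : ∑ i : Fin d, ∑ j : Fin d, (if i = j then X j * pderiv i p else 0) = C (n : ℝ) * p := by
    simp [euler]
  -- The conditional terms are zero off the diagonal; on it they cancel the first-order terms, as
  -- `rotDeriv i i` is zero.
  have key (i j : Fin d) : rotDeriv i j (rotDeriv i j p) =
      X i ^ 2 * pderiv j (pderiv j p) + X j ^ 2 * pderiv i (pderiv i p)
      - X i * X j * pderiv j (pderiv i p) - X i * X j * pderiv i (pderiv j p)
      - X i * pderiv i p - X j * pderiv j p
      + (if j = i then X i * pderiv j p else 0) + (if i = j then X j * pderiv i p else 0) := by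
    simp only [rotDeriv, map_sub, pderiv_mul, pderiv_X_self]
    by_cases hij : i = j
    · subst hij
      simp
      ring
    · rw [pderiv_X_of_ne hij, pderiv_X_of_ne (Ne.symm hij), if_neg hij, if_neg (Ne.symm hij)]
      ring
  simp only [key, Finset.sum_add_distrib, Finset.sum_sub_distrib, h1, h2, h3, h4, h5, h6, h7, h8]
  simp only [map_sub, map_add, map_mul, map_natCast, map_ofNat, C_1]
  ring

theorem hasDerivAt_eval {c : ℝ → Fin d → ℝ} {c' : Fin d → ℝ} {t : ℝ}
    (h : ∀ k, HasDerivAt (fun s => c s k) (c' k) t) (p : MvPolynomial (Fin d) ℝ) :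
    HasDerivAt (fun s => eval (c s) p) (∑ k, c' k * eval (c t) (pderiv k p)) t := by
  induction p using MvPolynomial.induction_on with
  | C a => simpa using hasDerivAt_const t a
  | add p q hp hq =>
    simp only [map_add, mul_add, Finset.sum_add_distrib]
    exact hp.add hq
  | mul_X p i hp =>
    simp only [eval_mul, eval_X]
    refine (hp.fun_mul (h i)).congr_deriv ?_
    have h1 (k : Fin d) : c' k * eval (c t) (pderiv k (p * X i)) =
        c' k * eval (c t) (pderiv k p) * c t i + if k = i then eval (c t) p * c' i else 0 := by
      rw [pderiv_mul]
      split_ifs with hk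
      · subst hk
        simp
        ring
      · simp [pderiv_X_of_ne (Ne.symm hk), mul_assoc]
    simp only [h1, Finset.sum_add_distrib, Finset.sum_mul, Finset.sum_ite_eq', Finset.mem_univ,
      if_true]

end MvPolynomial

/-! ### Invariance of the surface measure and orthogonality of harmonics. -/

/-- The action of a linear isometry on the sphere. -/
noncomputable def sphereHomeomorph {d : ℕ}
    (g : EuclideanSpace ℝ (Fin d) ≃ₗᵢ[ℝ] EuclideanSpace ℝ (Fin d)) : USphere d ≃ₜ USphere d :=
  g.toHomeomorph.subtype fun x => by simp

-- The surface measure of a set is a multiple of the Lebesgue measure of the cone over it, and the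
-- isometry carries cones to cones and preserves Lebesgue measure.
open scoped Pointwise in
theorem measurePreserving_sphereHomeomorph {d : ℕ}
    (g : EuclideanSpace ℝ (Fin d) ≃ₗᵢ[ℝ] EuclideanSpace ℝ (Fin d)) :
    MeasurePreserving (sphereHomeomorph g) (uniformMeasure d) (uniformMeasure d) := by
  refine ⟨(sphereHomeomorph g).continuous.measurable, ?_⟩
  ext s hs
  rw [Measure.map_apply (sphereHomeomorph g).continuous.measurable hs]
  simp only [uniformMeasure, Measure.smul_apply]
  congr 1
  rw [Measure.toSphere_apply' _ hs,
    Measure.toSphere_apply' _ ((sphereHomeomorph g).continuous.measurable hs)]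
  congr 1
  have h :
      Set.Ioo (0 : ℝ) 1 • ((↑) '' (sphereHomeomorph g ⁻¹' s) : Set (EuclideanSpace ℝ (Fin d))) =
      g ⁻¹' (Set.Ioo (0 : ℝ) 1 • ((↑) '' s)) := by
    ext x
    simp only [Set.mem_smul, Set.mem_image, Set.mem_preimage]
    constructor
    · rintro ⟨r, hr, _, ⟨y, hy, rfl⟩, rfl⟩
      exact ⟨r, hr, _, ⟨_, hy, rfl⟩, by simp [sphereHomeomorph]⟩
    · rintro ⟨r, hr, _, ⟨y, hy, rfl⟩, h⟩
      refine ⟨r, hr, _, ⟨(sphereHomeomorph g).symm y, by simpa using hy, rfl⟩, ?_⟩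
      apply g.injective
      rw [← h, map_smul]
      congr 1
      exact congrArg Subtype.val ((sphereHomeomorph g).apply_symm_apply y)
  rw [h]
  exact MeasurePreserving.measure_preimage_equiv (f := g.toMeasurableEquiv) g.measurePreserving _

theorem integral_uniformMeasure_comp {d : ℕ}
    (g : EuclideanSpace ℝ (Fin d) ≃ₗᵢ[ℝ] EuclideanSpace ℝ (Fin d))
    (F : EuclideanSpace ℝ (Fin d) → ℝ) :
    ∫ x : USphere d, F (g x) ∂uniformMeasure d = ∫ x : USphere d, F x ∂uniformMeasure d :=
  (measurePreserving_sphereHomeomorph g).integral_comp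
    (sphereHomeomorph g).measurableEmbedding fun x => F x

theorem continuous_restrictToSphere (d : ℕ) (p : MvPolynomial (Fin d) ℝ) :
    Continuous (restrictToSphere d p) := by
  have h : Continuous fun x : USphere d => fun i => x.1 i := by fun_prop
  exact (MvPolynomial.continuous_eval p).comp h

theorem Continuous.integrable_sphere {d : ℕ} {F : USphere d → ℝ} (hF : Continuous F)
    (μ : Measure (USphere d)) [IsFiniteMeasure μ] : Integrable F μ := by
  rw [← integrableOn_univ]
  exact hF.continuousOn.integrableOn_compact isCompact_univ

/-- If the integrals of polynomials do not change along a family of maps `c t`, then the integral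
of the derivative of a polynomial along the family vanishes. -/
theorem integral_deriv_eq_zero {d : ℕ} {μ : Measure (USphere d)} [IsFiniteMeasure μ]
    {c c' : ℝ → USphere d → Fin d → ℝ}
    (hc : Continuous fun z : ℝ × USphere d => c z.1 z.2)
    (hc' : Continuous fun z : ℝ × USphere d => c' z.1 z.2)
    (hderiv : ∀ t x k, HasDerivAt (fun t => c t x k) (c' t x k) t) (p : MvPolynomial (Fin d) ℝ)
    {I : ℝ} (hI : ∀ t, ∫ x, MvPolynomial.eval (c t x) p ∂μ = I) :
    ∫ x, ∑ k, c' 0 x k * MvPolynomial.eval (c 0 x) (MvPolynomial.pderiv k p) ∂μ = 0 := by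
  have hF' : Continuous fun z : ℝ × USphere d =>
      ∑ k, c' z.1 z.2 k * MvPolynomial.eval (c z.1 z.2) (MvPolynomial.pderiv k p) :=
    continuous_finsetSum _ fun k _ =>
      ((continuous_apply k).comp hc').mul ((MvPolynomial.continuous_eval _).comp hc)
  have hF : Continuous fun z : ℝ × USphere d => MvPolynomial.eval (c z.1 z.2) p :=
    (MvPolynomial.continuous_eval _).comp hc
  obtain ⟨B, hB⟩ := ((isCompact_Icc (a := (-1 : ℝ)) (b := 1)).prod
    (isCompact_univ (X := USphere d))).exists_bound_of_continuousOn hF'.continuousOn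
  have hpair (t : ℝ) : Continuous fun x : USphere d => (t, x) := by fun_prop
  have h1 := (hasDerivAt_integral_of_dominated_loc_of_deriv_le (μ := μ)
    (F := fun t x => MvPolynomial.eval (c t x) p)
    (F' := fun t x => ∑ k, c' t x k * MvPolynomial.eval (c t x) (MvPolynomial.pderiv k p))
    (x₀ := 0) (bound := fun _ => B) (Icc_mem_nhds (by norm_num) one_pos)
    (Filter.Eventually.of_forall fun t => (hF.comp (hpair t)).aestronglyMeasurable)
    ((hF.comp (hpair 0)).integrable_sphere _) (hF'.comp (hpair 0)).aestronglyMeasurable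
    (Filter.Eventually.of_forall fun x t ht => hB (t, x) ⟨ht, trivial⟩) (integrable_const _)
    (Filter.Eventually.of_forall fun x t _ =>
      MvPolynomial.hasDerivAt_eval (fun k => hderiv t x k) p)).2
  simp only [hI] at h1
  exact h1.unique (hasDerivAt_const _ _)

/-- The reflection in the line spanned by `cos t e_i + sin t e_j`, in coordinates. -/
theorem exists_planeReflection {d : ℕ} {i j : Fin d} (hij : i ≠ j) (t : ℝ) :
    ∃ g : EuclideanSpace ℝ (Fin d) ≃ₗᵢ[ℝ] EuclideanSpace ℝ (Fin d), ∀ x k,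
      g x k = 2 * ((Real.cos t * x i + Real.sin t * x j) *
        (Real.cos t * (if k = i then 1 else 0) + Real.sin t * (if k = j then 1 else 0))) - x k := by
  let w : EuclideanSpace ℝ (Fin d) := Real.cos t • EuclideanSpace.single i 1 +
    Real.sin t • EuclideanSpace.single j 1
  have hin (x : EuclideanSpace ℝ (Fin d)) :
      inner ℝ w x = Real.cos t * x i + Real.sin t * x j := by
    simp [w, inner_add_left, inner_smul_left, EuclideanSpace.inner_single_left]
  have hw : ‖w‖ = 1 := by
    have h : ‖w‖ ^ 2 = 1 := by
      rw [← real_inner_self_eq_norm_sq, hin]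
      simp [w, hij, hij.symm]
      nlinarith [Real.cos_sq_add_sin_sq t]
    exact (pow_eq_one_iff_of_nonneg (norm_nonneg _) two_ne_zero).1 h
  refine ⟨(ℝ ∙ w).reflection, fun x k => ?_⟩
  rw [Submodule.reflection_apply, Submodule.starProjection_unit_singleton ℝ hw, hin]
  simp only [w, PiLp.sub_apply, PiLp.add_apply, PiLp.smul_apply, PiLp.single_apply,
    smul_eq_mul, nsmul_eq_mul, Nat.cast_ofNat]

theorem isFiniteMeasure_uniformMeasure {d : ℕ} (hd : 2 ≤ d) : IsFiniteMeasure (uniformMeasure d) :=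
  have := isProbabilityMeasure_uniformMeasure d (by omega)
  inferInstance

/-- The integral of a polynomial over the sphere is invariant under infinitesimal rotations. -/
theorem integral_rotDeriv {d : ℕ} (hd : 2 ≤ d) (i j : Fin d) (p : MvPolynomial (Fin d) ℝ) :
    ∫ x, restrictToSphere d (MvPolynomial.rotDeriv i j p) x ∂uniformMeasure d = 0 := by
  have := isFiniteMeasure_uniformMeasure hd
  rcases eq_or_ne i j with rfl | hij
  · simp [MvPolynomial.rotDeriv]
  choose g hg using fun t => exists_planeReflection hij t
  have hint (t : ℝ) (q : MvPolynomial (Fin d) ℝ) :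
      ∫ x : USphere d, MvPolynomial.eval (fun k => g t x k) q ∂uniformMeasure d =
        ∫ x, restrictToSphere d q x ∂uniformMeasure d :=
    integral_uniformMeasure_comp (g t) fun x => MvPolynomial.eval (fun k => x k) q
  have h2 := integral_deriv_eq_zero (μ := uniformMeasure d)
    (c := fun t x k => g t x k)
    (c' := fun t x k => 2 * ((-Real.sin t * x.1 i + Real.cos t * x.1 j) *
        (Real.cos t * (if k = i then 1 else 0) + Real.sin t * (if k = j then 1 else 0)) +
        (Real.cos t * x.1 i + Real.sin t * x.1 j) *
        (-Real.sin t * (if k = i then 1 else 0) + Real.cos t * (if k = j then 1 else 0))))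
    (by simp only [hg]; fun_prop) (by fun_prop) (fun t x k => ?_) p (hint · p)
  · have h3 (x : USphere d) := hg 0 x
    -- In its plane the reflected point turns at twice the speed of the line, so its velocity is
    -- twice the rotation field at `g 0 x`; the other coordinates do not move. Evaluation at `g 0 x`
    -- instead of `x` is harmless by invariance.
    have h4 (x : USphere d) : 2 * MvPolynomial.eval (fun k => g 0 x k) (MvPolynomial.rotDeriv i j p)
        = ∑ k, 2 * ((-Real.sin 0 * x.1 i + Real.cos 0 * x.1 j) *
        (Real.cos 0 * (if k = i then 1 else 0) + Real.sin 0 * (if k = j then 1 else 0)) +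
        (Real.cos 0 * x.1 i + Real.sin 0 * x.1 j) *
        (-Real.sin 0 * (if k = i then 1 else 0) + Real.cos 0 * (if k = j then 1 else 0))) *
        MvPolynomial.eval (fun k => g 0 x k) (MvPolynomial.pderiv k p) := by
      have h5 : g 0 x i = x.1 i := by rw [h3]; simp; ring
      have h6 : g 0 x j = -x.1 j := by rw [h3]; simp [hij.symm]
      simp only [MvPolynomial.rotDeriv, map_sub, map_mul, MvPolynomial.eval_X, h5, h6,
        Real.sin_zero, Real.cos_zero]
      simp [mul_add, add_mul, Finset.sum_add_distrib]
      ring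
    simp only [← h4, integral_const_mul, hint] at h2
    linarith
  · simp only [hg]
    exact (((((Real.hasDerivAt_cos t).mul_const _).fun_add
      ((Real.hasDerivAt_sin t).mul_const _)).fun_mul (((Real.hasDerivAt_cos t).mul_const _).fun_add
      ((Real.hasDerivAt_sin t).mul_const _))).const_mul 2).sub_const _

theorem restrictToSphere_mul {d : ℕ} (p q : MvPolynomial (Fin d) ℝ) :
    restrictToSphere d (p * q) = restrictToSphere d p * restrictToSphere d q := by
  ext x
  simp [restrictToSphere]

/-- Spherical harmonics of different orders are orthogonal in `L²(σ)`. -/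
theorem integral_mul_sphericalHarmonics {d : ℕ} (hd : 2 ≤ d) {n k : ℕ} (hnk : n ≠ k)
    {Y Y' : USphere d → ℝ} (hY : Y ∈ sphericalHarmonics d n) (hY' : Y' ∈ sphericalHarmonics d k) :
    ∫ x, Y x * Y' x ∂uniformMeasure d = 0 := by
  have := isFiniteMeasure_uniformMeasure hd
  obtain ⟨p, ⟨hp, hp'⟩, rfl⟩ := hY
  obtain ⟨q, ⟨hq, hq'⟩, rfl⟩ := hY'
  let J : MvPolynomial (Fin d) ℝ →ₗ[ℝ] ℝ :=
    { toFun := fun r => ∫ x, restrictToSphere d r x ∂uniformMeasure d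
      map_add' := fun r s => by
        simp only [map_add, Pi.add_apply]
        exact integral_add ((continuous_restrictToSphere d r).integrable_sphere _)
          ((continuous_restrictToSphere d s).integrable_sphere _)
      map_smul' := fun a r => by
        simp only [map_smul, Pi.smul_apply, smul_eq_mul, RingHom.id_apply, integral_const_mul] }
  have hJ (i j : Fin d) (r : MvPolynomial (Fin d) ℝ) : J (MvPolynomial.rotDeriv i j r) = 0 :=
    integral_rotDeriv hd i j r
  have hskew (i j : Fin d) (r s : MvPolynomial (Fin d) ℝ) :
      J (MvPolynomial.rotDeriv i j r * s) = -J (r * MvPolynomial.rotDeriv i j s) := by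
    have := hJ i j (r * s)
    rw [MvPolynomial.rotDeriv_mul, map_add] at this
    linarith
  -- Each rotation field is skew for `J`, so its square is symmetric.
  have hsymm : J ((∑ i, ∑ j, MvPolynomial.rotDeriv i j (MvPolynomial.rotDeriv i j p)) * q) =
      J (p * ∑ i, ∑ j, MvPolynomial.rotDeriv i j (MvPolynomial.rotDeriv i j q)) := by
    simp only [Finset.sum_mul, Finset.mul_sum, map_sum, hskew, neg_neg]
  have h0 : polyLaplacian d p = 0 := hp'
  have h0' : polyLaplacian d q = 0 := hq'
  rw [MvPolynomial.sum_rotDeriv_rotDeriv hp, MvPolynomial.sum_rotDeriv_rotDeriv hq,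
    h0, h0'] at hsymm
  simp only [mul_zero, zero_sub, neg_mul, mul_neg, map_neg] at hsymm
  rw [mul_left_comm, ← MvPolynomial.smul_eq_C_mul, ← MvPolynomial.smul_eq_C_mul, smul_mul_assoc,
    map_smul, map_smul, smul_eq_mul, smul_eq_mul] at hsymm
  -- The eigenvalue difference `n (n + d - 2) - k (k + d - 2)` factors; the second factor is
  -- positive because `n + k ≥ 1` and `d ≥ 2`.
  have h1 : ((n : ℝ) - k) * (n + k + d - 2) * J (p * q) = 0 := by linear_combination -hsymm / 2
  have h2 : (n : ℝ) - k ≠ 0 := sub_ne_zero.2 (by exact_mod_cast hnk)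
  have h3 : (n : ℝ) + k + d - 2 ≠ 0 := by
    have h4 : (1 : ℝ) ≤ n + k := by
      have : 1 ≤ n + k := by omega
      exact_mod_cast this
    have h5 : (2 : ℝ) ≤ d := by exact_mod_cast hd
    linarith
  have h4 : J (p * q) = 0 := by simpa [h2, h3] using h1
  rw [← h4]
  simp only [J, LinearMap.coe_mk, AddHom.coe_mk, restrictToSphere_mul, Pi.mul_apply]

/-! ### Carathéodory's theorem and the reduction of the number of atoms. -/

/-- In finite dimension, the convex hull of a compact set is compact. -/
theorem IsCompact.convexHull_of_finiteDimensional {E : Type*} [NormedAddCommGroup E]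
    [NormedSpace ℝ E] [FiniteDimensional ℝ E] {S : Set E} (hS : IsCompact S) :
    IsCompact (convexHull ℝ S) := by
  -- By Carathéodory the hull is a finite union of continuous images of a simplex times a power of
  -- `S`.
  have h : convexHull ℝ S = ⋃ k ∈ Set.Iic (Module.finrank ℝ E + 1),
      (fun z : (Fin k → ℝ) × (Fin k → E) => ∑ i, z.1 i • z.2 i) ''
        (stdSimplex ℝ (Fin k) ×ˢ Set.univ.pi fun _ => S) := by
    ext v
    simp only [Set.mem_iUnion, Set.mem_image, Prod.exists, Set.mem_prod, Set.mem_univ_pi]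
    constructor
    · intro hv
      obtain ⟨ι, _, z, w, hz, hind, hw, hw1, rfl⟩ := eq_pos_convex_span_of_mem_convexHull hv
      have hcard : Fintype.card ι ≤ Module.finrank ℝ E + 1 :=
        hind.card_le_finrank_succ.trans (Nat.add_le_add_right (Submodule.finrank_le _) 1)
      let e := (Fintype.equivFin ι).symm
      refine ⟨Fintype.card ι, hcard, w ∘ e, z ∘ e, ⟨⟨fun i => (hw _).le, ?_⟩,
        fun i => hz ⟨_, rfl⟩⟩, ?_⟩
      · rw [← hw1]; exact e.sum_comp w
      · exact e.sum_comp fun i => w i • z i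
    · rintro ⟨k, -, w, z, ⟨hw, hz⟩, rfl⟩
      exact (convex_convexHull ℝ S).sum_mem (fun i _ => hw.1 i) hw.2
        fun i _ => subset_convexHull ℝ S (hz i)
  rw [h]
  refine (Set.finite_Iic _).isCompact_biUnion fun k _ => IsCompact.image ?_ (by fun_prop)
  exact (isCompact_stdSimplex ℝ (Fin k)).prod (isCompact_univ_pi fun _ => hS)

section Reduction

variable {X ι V : Type*} [Fintype ι] [AddCommGroup V] [Module ℝ V]

/-- The energy of the weights `p` at the points `x a`, for the kernel `∑ i, w i * φ i x * φ i y`. -/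
def pointEnergy (w : ι → ℝ) (φ : ι → X → ℝ) {A : Type*} [Fintype A] (x : A → X) (p : A → ℝ) : ℝ :=
  ∑ i, w i * (∑ a, p a * φ i (x a)) ^ 2

theorem pointEnergy_add_smul (w : ι → ℝ) (φ : ι → X → ℝ) {A : Type*} [Fintype A] (x : A → X)
    (p t : A → ℝ) (s : ℝ) : pointEnergy w φ x (p + s • t) = pointEnergy w φ x p +
      2 * s * ∑ i, w i * ((∑ a, p a * φ i (x a)) * ∑ a, t a * φ i (x a)) +
      s ^ 2 * pointEnergy w φ x t := by
  simp only [pointEnergy, Finset.mul_sum (Finset.univ : Finset ι), ← Finset.sum_add_distrib]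
  refine Finset.sum_congr rfl fun i _ => ?_
  have h : ∑ a, (p + s • t) a * φ i (x a) = ∑ a, p a * φ i (x a) + s * ∑ a, t a * φ i (x a) := by
    rw [Finset.mul_sum, ← Finset.sum_add_distrib]
    exact Finset.sum_congr rfl fun a _ => by simp; ring
  rw [h]
  ring

/-- If the energy is concave in the directions annihilated by `L`, then one of the more than `dim V`
positive weights can be made zero without increasing the energy. -/
theorem exists_pointEnergy_le_of_finrank_lt [Module.Finite ℝ V] {w : ι → ℝ} {φ : ι → X → ℝ}
    {L : X → V} {A : Type*} [Fintype A] {x : A → X} {p : A → ℝ} (hp : ∀ a, 0 < p a)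
    (hL : ∀ t : A → ℝ, ∑ a, t a • L (x a) = 0 → ∑ a, t a = 0 ∧ pointEnergy w φ x t ≤ 0)
    (hA : Module.finrank ℝ V < Fintype.card A) :
    ∃ r : A → ℝ, (∀ a, 0 ≤ r a) ∧ ∑ a, r a = ∑ a, p a ∧ (∃ a, r a = 0) ∧
      pointEnergy w φ x r ≤ pointEnergy w φ x p := by
  -- There are more atoms than dimensions, so a linear relation `t` exists; its sign is chosen so
  -- that the first-order change of the energy is not positive.
  obtain ⟨t, ht0, htL, htb⟩ : ∃ t : A → ℝ, t ≠ 0 ∧ ∑ a, t a • L (x a) = 0 ∧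
      ∑ i, w i * ((∑ a, p a * φ i (x a)) * ∑ a, t a * φ i (x a)) ≤ 0 := by
    have hker := LinearMap.ker_ne_bot_of_finrank_lt
      (f := Fintype.linearCombination ℝ (fun a => L (x a))) (by simpa using hA)
    obtain ⟨t, ht, ht0⟩ := (Submodule.ne_bot_iff _).1 hker
    have ht' : ∑ a, t a • L (x a) = 0 := by
      simpa [Fintype.linearCombination_apply] using ht
    rcases le_total (∑ i, w i * ((∑ a, p a * φ i (x a)) * ∑ a, t a * φ i (x a))) 0 with h | h
    · exact ⟨t, ht0, ht', h⟩
    · exact ⟨-t, neg_ne_zero.2 ht0, by simp [ht'], by simpa using h⟩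
  obtain ⟨hsum, hE⟩ := hL t htL
  obtain ⟨a₀, ha₀⟩ : ∃ a, t a < 0 := by
    by_contra! h
    exact ht0 (funext fun a => (Finset.sum_eq_zero_iff_of_nonneg fun a _ => h a).1 hsum a
      (Finset.mem_univ a))
  -- The weight at `b` is the first to reach zero along `t`, and the step `s` below is the time at
  -- which it does.
  obtain ⟨b, hb, hmin⟩ := Finset.exists_min_image (Finset.univ.filter fun a => t a < 0)
    (fun a => p a / -t a) ⟨a₀, by simpa using ha₀⟩
  have hb' : t b < 0 := by simpa using hb
  set s := p b / -t b with hs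
  have hs0 : 0 < s := div_pos (hp b) (neg_pos.2 hb')
  refine ⟨p + s • t, fun a => ?_, ?_, ⟨b, ?_⟩, ?_⟩
  · simp only [Pi.add_apply, Pi.smul_apply, smul_eq_mul]
    rcases lt_or_ge (t a) 0 with h | h
    · have h1 := hmin a (by simpa using h)
      rw [le_div_iff₀ (neg_pos.2 h)] at h1
      linarith
    · have := hp a
      positivity
  · simp [Finset.sum_add_distrib, ← Finset.mul_sum, hsum]
  · simp only [Pi.add_apply, Pi.smul_apply, smul_eq_mul, hs]
    field_simp [hb'.ne]
    ring
  · rw [pointEnergy_add_smul]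
    nlinarith [mul_nonneg (sq_nonneg s) (neg_nonneg.2 hE), mul_nonneg hs0.le (neg_nonneg.2 htb)]

/-- Atoms whose weight has become zero are discarded and the reduction is repeated; the bound `k` on
the number of atoms drives the induction. As the atoms change, `hL` is required for all finite
families. -/
theorem exists_pointEnergy_le_card_le_finrank [Module.Finite ℝ V] {w : ι → ℝ} {φ : ι → X → ℝ}
    {L : X → V} (hL : ∀ {A : Type} [Fintype A] (x : A → X) (t : A → ℝ), ∑ a, t a • L (x a) = 0 →
      ∑ a, t a = 0 ∧ pointEnergy w φ x t ≤ 0) (k : ℕ) {A : Type} [Fintype A]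
    (hk : Fintype.card A ≤ k) (x : A → X) {p : A → ℝ} (hp : ∀ a, 0 < p a) :
    ∃ (B : Type) (_ : Fintype B) (y : B → X) (r : B → ℝ), Fintype.card B ≤ Module.finrank ℝ V ∧
      (∀ b, 0 < r b) ∧ ∑ b, r b = ∑ a, p a ∧ pointEnergy w φ y r ≤ pointEnergy w φ x p := by
  classical
  induction k generalizing A with
  | zero => exact ⟨A, inferInstance, x, p, hk.trans (Nat.zero_le _), hp, rfl, le_rfl⟩
  | succ k ih =>
    rcases le_or_gt (Fintype.card A) (Module.finrank ℝ V) with h | h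
    · exact ⟨A, inferInstance, x, p, h, hp, rfl, le_rfl⟩
    obtain ⟨r, hr, hr1, ⟨b, hb⟩, hrE⟩ := exists_pointEnergy_le_of_finrank_lt hp (hL x) h
    have hcard : Fintype.card {a // r a ≠ 0} ≤ k := by
      have : Fintype.card {a // r a ≠ 0} < Fintype.card A :=
        Fintype.card_subtype_lt (x := b) (by simpa using hb)
      omega
    have hsub (F : A → ℝ) : ∑ a : {a // r a ≠ 0}, r a * F a = ∑ a, r a * F a := by
      rw [← Finset.sum_subtype (Finset.univ.filter (r · ≠ 0)) (by simp) fun a => r a * F a]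
      exact Finset.sum_filter_of_ne fun a _ h => left_ne_zero_of_mul h
    obtain ⟨B, hB, y, q, h1, h2, h3, h4⟩ := ih hcard (fun a : {a // r a ≠ 0} => x a)
      (p := fun a => r a) fun a => (hr a).lt_of_ne' a.2
    refine ⟨B, hB, y, q, h1, h2, h3.trans ?_, h4.trans (le_trans (le_of_eq ?_) hrE)⟩
    · simpa [hr1] using hsub fun _ => 1
    · exact Finset.sum_congr rfl fun i _ => by rw [hsub fun a => φ i (x a)]

end Reduction

/-! ### Measures with finitely many atoms. -/

section DiscreteMeasure

variable {d : ℕ} {A : Type*} [Fintype A]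

/-- The measure with weights `p a` at the points `x a`. -/
noncomputable def pointMeasure (x : A → USphere d) (p : A → ℝ) : Measure (USphere d) :=
  ∑ a, ENNReal.ofReal (p a) • Measure.dirac (x a)

theorem isProbabilityMeasure_pointMeasure (x : A → USphere d) {p : A → ℝ} (hp : ∀ a, 0 ≤ p a)
    (h1 : ∑ a, p a = 1) : IsProbabilityMeasure (pointMeasure x p) := by
  refine ⟨?_⟩
  simp [pointMeasure, ← ENNReal.ofReal_sum_of_nonneg fun a _ => hp a, h1]

theorem integral_pointMeasure (x : A → USphere d) {p : A → ℝ} (hp : ∀ a, 0 ≤ p a)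
    (F : USphere d → ℝ) : ∫ y, F y ∂pointMeasure x p = ∑ a, p a * F (x a) := by
  rw [pointMeasure, integral_finsetSum_measure fun a _ =>
    (integrable_dirac (by simp)).smul_measure (by simp)]
  simp [integral_smul_measure, hp]

theorem support_pointMeasure_subset (x : A → USphere d) (p : A → ℝ) :
    (pointMeasure x p).support ⊆ Set.range x := by
  refine Measure.support_subset_of_isClosed (Set.finite_range x).isClosed ?_
  rw [mem_ae_iff]
  simp [pointMeasure]

theorem encard_support_pointMeasure_le (x : A → USphere d) (p : A → ℝ) :
    (pointMeasure x p).support.encard ≤ (Fintype.card A : ℕ∞) := by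
  refine (Set.encard_le_encard (support_pointMeasure_subset x p)).trans ?_
  rw [← Set.image_univ]
  refine (Set.encard_image_le _ _).trans ?_
  simp

end DiscreteMeasure

/-! ### Energies of kernels of finite rank. -/

section Kernel

variable {d : ℕ} {ι : Type*} [Fintype ι] {f : ℝ → ℝ} {w : ι → ℝ} {φ : ι → USphere d → ℝ}

theorem integral_kernel (hf : ∀ x y : USphere d, f (inner ℝ x.1 y.1) = ∑ i, w i * φ i x * φ i y)
    (hφ : ∀ i, Continuous (φ i)) (ν : Measure (USphere d)) [IsFiniteMeasure ν] (x : USphere d) :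
    ∫ y : USphere d, f (inner ℝ x.1 y.1) ∂ν = ∑ i, w i * φ i x * ∫ y, φ i y ∂ν := by
  simp only [hf]
  rw [integral_finsetSum _ fun i _ => ((hφ i).integrable_sphere ν).const_mul _]
  simp only [integral_const_mul]

theorem integral_integral_kernel
    (hf : ∀ x y : USphere d, f (inner ℝ x.1 y.1) = ∑ i, w i * φ i x * φ i y)
    (hφ : ∀ i, Continuous (φ i)) (μ ν : Measure (USphere d)) [IsFiniteMeasure μ]
    [IsFiniteMeasure ν] : ∫ x : USphere d, ∫ y : USphere d, f (inner ℝ x.1 y.1) ∂ν ∂μ =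
      ∑ i, w i * (∫ x, φ i x ∂μ) * ∫ y, φ i y ∂ν := by
  simp only [integral_kernel hf hφ]
  rw [integral_finsetSum _ fun i _ => (((hφ i).integrable_sphere μ).const_mul _).mul_const _]
  simp only [integral_const_mul, integral_mul_const]

theorem energy_eq_sum (hf : ∀ x y : USphere d, f (inner ℝ x.1 y.1) = ∑ i, w i * φ i x * φ i y)
    (hφ : ∀ i, Continuous (φ i)) (μ : Measure (USphere d)) [IsFiniteMeasure μ] :
    energy f μ = ∑ i, w i * (∫ x, φ i x ∂μ) ^ 2 := by
  rw [energy, integral_integral_kernel hf hφ]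
  exact Finset.sum_congr rfl fun i _ => by ring

theorem energy_pointMeasure
    (hf : ∀ x y : USphere d, f (inner ℝ x.1 y.1) = ∑ i, w i * φ i x * φ i y)
    (hφ : ∀ i, Continuous (φ i)) {A : Type*} [Fintype A] (x : A → USphere d) {p : A → ℝ}
    (hp : ∀ a, 0 ≤ p a) (h1 : ∑ a, p a = 1) :
    energy f (pointMeasure x p) = pointEnergy w φ x p := by
  have := isProbabilityMeasure_pointMeasure x hp h1
  simp only [energy_eq_sum hf hφ, integral_pointMeasure x hp, pointEnergy]

/-- The energy of a kernel of finite rank has a minimizer with finitely many atoms. -/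
theorem exists_isEnergyMinimizer_pointMeasure (hd : 1 ≤ d)
    (hf : ∀ x y : USphere d, f (inner ℝ x.1 y.1) = ∑ i, w i * φ i x * φ i y)
    (hφ : ∀ i, Continuous (φ i)) : ∃ (A : Type) (_ : Fintype A) (x : A → USphere d) (p : A → ℝ),
      (∀ a, 0 < p a) ∧ ∑ a, p a = 1 ∧ IsEnergyMinimizer f (pointMeasure x p) := by
  have := isProbabilityMeasure_uniformMeasure d hd
  have hne : Nonempty (USphere d) := (uniformMeasure d).nonempty_of_neZero
  set Φ : USphere d → ι → ℝ := fun x i => φ i x with hΦ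
  have hΦc : Continuous Φ := continuous_pi hφ
  have hK : IsCompact (convexHull ℝ (Set.range Φ)) :=
    (isCompact_range hΦc).convexHull_of_finiteDimensional
  -- The energy of a measure depends only on the integral of `Φ`, which lies in this hull.
  obtain ⟨v, hv, hmin⟩ := hK.exists_isMinOn ((Set.range_nonempty Φ).convexHull)
    (f := fun v : ι → ℝ => ∑ i, w i * v i ^ 2) (by fun_prop)
  obtain ⟨n, x, p, hp, hp1, hx⟩ : ∃ (n : ℕ) (x : Fin n → USphere d) (p : Fin n → ℝ),
      (∀ a, 0 < p a) ∧ ∑ a, p a = 1 ∧ ∑ a, p a • Φ (x a) = v := by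
    obtain ⟨A, _, z, p, hz, -, hp, hp1, hv⟩ := eq_pos_convex_span_of_mem_convexHull hv
    choose x hx using fun a => hz ⟨a, rfl⟩
    let e := (Fintype.equivFin A).symm
    refine ⟨_, x ∘ e, p ∘ e, fun a => hp _, ?_, ?_⟩
    · rw [← hp1]; exact e.sum_comp p
    · rw [← hv]
      simp only [Function.comp_apply, hx]
      exact e.sum_comp fun a => p a • z a
  have hp0 (a) : 0 ≤ p a := (hp a).le
  refine ⟨Fin n, inferInstance, x, p, hp, hp1, isProbabilityMeasure_pointMeasure x hp0 hp1,
    fun ν hν => ?_⟩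
  have hmem : ∫ y, Φ y ∂ν ∈ convexHull ℝ (Set.range Φ) := by
    refine (convex_convexHull ℝ _).integral_mem hK.isClosed
      (Filter.Eventually.of_forall fun y => subset_convexHull ℝ _ ⟨y, rfl⟩) ?_
    exact Integrable.of_eval fun i => (hφ i).integrable_sphere ν
  have h := hmin hmem
  simp only [Set.mem_ofPred_eq] at h
  rw [energy_pointMeasure hf hφ x hp0 hp1, energy_eq_sum hf hφ]
  refine le_trans (le_of_eq ?_) (h.trans (le_of_eq ?_))
  · simp [pointEnergy, ← hx, hΦ]
  · refine Finset.sum_congr rfl fun i _ => ?_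
    rw [eval_integral fun i => (hφ i).integrable_sphere ν]

end Kernel

/-! ### Zeros of polynomials on the sphere. -/

theorem exists_cos_sin_eq {c s : ℝ} (h : c ^ 2 + s ^ 2 = 1) :
    ∃ θ ∈ Set.Icc (-Real.pi) Real.pi, Real.cos θ = c ∧ Real.sin θ = s := by
  have hn : ‖(⟨c, s⟩ : ℂ)‖ = 1 := by
    rw [← sq_eq_sq₀ (norm_nonneg _) zero_le_one, Complex.sq_norm, Complex.normSq_mk]
    linarith
  refine ⟨Complex.arg ⟨c, s⟩, ⟨(Complex.neg_pi_lt_arg _).le, Complex.arg_le_pi _⟩, ?_, ?_⟩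
  · simpa [hn] using Complex.norm_mul_cos_arg ⟨c, s⟩
  · simpa [hn] using Complex.norm_mul_sin_arg ⟨c, s⟩

/-- A polynomial vanishing at points of a great circle that accumulate vanishes on it. -/
theorem eval_greatCircle_eq_zero {d : ℕ} {u v : Fin d → ℝ} {q : MvPolynomial (Fin d) ℝ} {θ₀ : ℝ}
    (h : ∃ᶠ θ in nhdsWithin θ₀ {θ₀}ᶜ,
      MvPolynomial.eval (fun k => Real.cos θ * u k + Real.sin θ * v k) q = 0) (θ : ℝ) :
    MvPolynomial.eval (fun k => Real.cos θ * u k + Real.sin θ * v k) q = 0 := by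
  have ha : AnalyticOnNhd ℝ
      (fun θ => MvPolynomial.eval (fun k => Real.cos θ * u k + Real.sin θ * v k) q) Set.univ := by
    intro t _
    have hk (k : Fin d) : AnalyticAt ℝ (fun θ => Real.cos θ * u k + Real.sin θ * v k) t :=
      (Real.analyticAt_cos.mul analyticAt_const).add (Real.analyticAt_sin.mul analyticAt_const)
    exact AnalyticAt.aeval_mvPolynomial hk q
  exact congrFun (ha.eq_of_frequently_eq (g := fun _ => 0) analyticOnNhd_const h) θ

/-- Provides a great circle through any two points, by Gram–Schmidt. -/
theorem exists_orthonormal_plane {d : ℕ} (hd : 2 ≤ d) {x y : EuclideanSpace ℝ (Fin d)}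
    (hx : ‖x‖ = 1) (hy : ‖y‖ = 1) : ∃ (v : EuclideanSpace ℝ (Fin d)) (θ : ℝ), ‖v‖ = 1 ∧
      inner ℝ x v = 0 ∧ y = Real.cos θ • x + Real.sin θ • v := by
  obtain ⟨v, s, hv, hxv, hyv⟩ : ∃ (v : EuclideanSpace ℝ (Fin d)) (s : ℝ), ‖v‖ = 1 ∧
      inner ℝ x v = 0 ∧ y = (inner ℝ x y : ℝ) • x + s • v := by
    have hxx : inner ℝ x x = (1 : ℝ) := by rw [real_inner_self_eq_norm_sq, hx, one_pow]
    by_cases hz : y - (inner ℝ x y : ℝ) • x = 0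
    -- Here `y` is a multiple of `x` and determines no direction; any unit vector orthogonal to `x`
    -- serves, and one exists because `d ≥ 2`.
    · have : Nontrivial (ℝ ∙ x)ᗮ := by
        have h1 := (ℝ ∙ x).finrank_add_finrank_orthogonal
        have hx0 : x ≠ 0 := by
          rintro rfl
          simp at hx
        rw [finrank_span_singleton hx0, finrank_euclideanSpace_fin] at h1
        exact Module.nontrivial_of_finrank_pos (R := ℝ) (by omega)
      obtain ⟨v, hv⟩ := exists_norm_eq (ℝ ∙ x)ᗮ zero_le_one
      exact ⟨v, 0, hv, Submodule.mem_orthogonal_singleton_iff_inner_right.1 v.2, by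
        simpa [sub_eq_zero] using hz⟩
    · set z := y - (inner ℝ x y : ℝ) • x with hzdef
      have hz' : ‖z‖ ≠ 0 := norm_ne_zero_iff.2 hz
      refine ⟨‖z‖⁻¹ • z, ‖z‖, by simp [norm_smul, hz'], ?_, ?_⟩
      · rw [inner_smul_right, hzdef, inner_sub_right, inner_smul_right, hxx]
        simp
      · rw [smul_smul, mul_inv_cancel₀ hz', one_smul, hzdef]
        abel
  have h1 : (inner ℝ x y : ℝ) ^ 2 + s ^ 2 = 1 := by
    have h2 : inner ℝ y y = (1 : ℝ) := by rw [real_inner_self_eq_norm_sq, hy, one_pow]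
    generalize (inner ℝ x y : ℝ) = c at *
    rw [hyv] at h2
    simp only [inner_add_left, inner_add_right, inner_smul_left, inner_smul_right, hxv,
      real_inner_comm x v, real_inner_self_eq_norm_sq, hx, hv] at h2
    simp at h2
    nlinarith
  obtain ⟨θ, -, hc, hs⟩ := exists_cos_sin_eq h1
  exact ⟨v, θ, hv, hxv, by rw [hc, hs]; exact hyv⟩

/-- On the great circle from an interior zero `x` to `y` the polynomial vanishes near `x`, hence
everywhere, by analyticity in the angle. -/
theorem restrictToSphere_eq_zero_of_interior {d : ℕ} (hd : 2 ≤ d) {q : MvPolynomial (Fin d) ℝ}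
    (h : (interior {x | restrictToSphere d q x = 0}).Nonempty) (y : USphere d) :
    restrictToSphere d q y = 0 := by
  obtain ⟨x, hx⟩ := h
  obtain ⟨v, θ, hv, hxv, hy⟩ := exists_orthonormal_plane hd (x := x.1) (y := y.1)
    (by simp) (by simp)
  have hnorm (t : ℝ) : ‖Real.cos t • x.1 + Real.sin t • v‖ = 1 := by
    have h1 : ‖Real.cos t • x.1 + Real.sin t • v‖ ^ 2 = 1 := by
      rw [norm_add_sq_real, inner_smul_left, inner_smul_right, hxv, norm_smul, norm_smul, hv]
      simp
    exact (pow_eq_one_iff_of_nonneg (norm_nonneg _) two_ne_zero).1 h1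
  let γ (t : ℝ) : USphere d := ⟨Real.cos t • x.1 + Real.sin t • v, by simpa using hnorm t⟩
  have hγ : Continuous γ := by
    refine Continuous.subtype_mk ?_ _
    fun_prop
  have hγ0 : γ 0 = x := Subtype.ext (by simp [γ])
  have hev : ∀ᶠ t in nhds (0 : ℝ), restrictToSphere d q (γ t) = 0 := by
    have := hγ.continuousAt.preimage_mem_nhds (x := 0)
      (by rw [hγ0]; exact mem_interior_iff_mem_nhds.1 hx)
    exact this
  have hfreq : ∃ᶠ t in nhdsWithin (0 : ℝ) {0}ᶜ,
      MvPolynomial.eval (fun k => Real.cos t * x.1 k + Real.sin t * v k) q = 0 :=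
    (hev.filter_mono nhdsWithin_le_nhds).frequently
  have := eval_greatCircle_eq_zero hfreq θ
  simpa [restrictToSphere, hy] using this

/-- Infinitely many angles in a compact interval accumulate, and the whole sphere is a single great
circle. -/
theorem restrictToSphere_eq_zero_of_infinite {q : MvPolynomial (Fin 2) ℝ}
    (h : {x | restrictToSphere 2 q x = 0}.Infinite) (y : USphere 2) :
    restrictToSphere 2 q y = 0 := by
  have hparam (x : USphere 2) : ∃ θ ∈ Set.Icc (-Real.pi) Real.pi, ∀ k, x.1 k =
      Real.cos θ * (Pi.single 0 1 : Fin 2 → ℝ) k + Real.sin θ * (Pi.single 1 1 : Fin 2 → ℝ) k := by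
    have hx := x.sum_sq
    rw [Fin.sum_univ_two] at hx
    obtain ⟨θ, hθ, hc, hs⟩ := exists_cos_sin_eq hx
    refine ⟨θ, hθ, fun k => ?_⟩
    fin_cases k <;> simp [hc, hs]
  choose θ hθ hxθ using hparam
  have hval (x : USphere 2) : restrictToSphere 2 q x = MvPolynomial.eval (fun k =>
      Real.cos (θ x) * (Pi.single 0 1 : Fin 2 → ℝ) k +
        Real.sin (θ x) * (Pi.single 1 1 : Fin 2 → ℝ) k) q := by
    simp only [← hxθ]
    rfl
  have hinj : Function.Injective θ := fun x y hxy => by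
    refine Subtype.ext (PiLp.ext fun k => ?_)
    rw [hxθ x, hxθ y, hxy]
  obtain ⟨t, -, ht⟩ := (h.image hinj.injOn).exists_accPt_of_subset_isCompact isCompact_Icc
    (Set.image_subset_iff.2 fun x _ => hθ x)
  rw [hval]
  refine eval_greatCircle_eq_zero ((accPt_iff_frequently_nhdsNE.1 ht).mono ?_) _
  rintro _ ⟨x, hx, rfl⟩
  rw [← hval]
  exact hx

theorem continuous_of_mem_sphericalHarmonics {d n : ℕ} {Y : USphere d → ℝ}
    (hY : Y ∈ sphericalHarmonics d n) : Continuous Y := by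
  obtain ⟨p, -, rfl⟩ := hY
  exact continuous_restrictToSphere d p

/-! ### Euler–Lagrange conditions. -/

section EulerLagrange

variable {d : ℕ} {ι : Type*} [Fintype ι] {f : ℝ → ℝ} {w : ι → ℝ} {φ : ι → USphere d → ℝ}

/-- Moving mass `s` from `μ` to the point `x` changes the energy by `2 s` times the potential at `x`
minus the energy, up to `O(s²)`. Dividing by `s` and letting `s` tend to 0 gives the inequality. -/
theorem IsEnergyMinimizer.energy_le_potential
    (hf : ∀ x y : USphere d, f (inner ℝ x.1 y.1) = ∑ i, w i * φ i x * φ i y)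
    (hφ : ∀ i, Continuous (φ i)) {μ : Measure (USphere d)} (hμ : IsEnergyMinimizer f μ)
    (x : USphere d) : energy f μ ≤ ∫ y : USphere d, f (inner ℝ x.1 y.1) ∂μ := by
  have hμp := hμ.1
  set M : ι → ℝ := fun i => ∫ y, φ i y ∂μ with hM
  have hstep (s : ℝ) (hs : 0 < s) (hs1 : s < 1) :
      0 ≤ 2 * ∑ i, w i * (M i * (φ i x - M i)) + s * ∑ i, w i * (φ i x - M i) ^ 2 := by
    let ν : Measure (USphere d) :=
      ENNReal.ofReal (1 - s) • μ + ENNReal.ofReal s • Measure.dirac x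
    have hν : IsProbabilityMeasure ν := by
      refine ⟨?_⟩
      simp only [ν, Measure.add_apply, Measure.smul_apply, measure_univ, smul_eq_mul, mul_one]
      rw [← ENNReal.ofReal_add (by linarith) hs.le]
      simp
    have hint (i : ι) : ∫ y, φ i y ∂ν = M i + s * (φ i x - M i) := by
      rw [integral_add_measure (((hφ i).integrable_sphere μ).smul_measure (by simp))
        (((hφ i).integrable_sphere _).smul_measure (by simp)), integral_smul_measure,
        integral_smul_measure, integral_dirac, ENNReal.toReal_ofReal (by linarith),
        ENNReal.toReal_ofReal hs.le, smul_eq_mul, smul_eq_mul]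
      ring
    have h := hμ.2 ν hν
    rw [energy_eq_sum hf hφ, energy_eq_sum hf hφ] at h
    simp only [hint] at h
    have h1 : ∑ i, w i * (M i + s * (φ i x - M i)) ^ 2 - ∑ i, w i * M i ^ 2 =
        s * (2 * ∑ i, w i * (M i * (φ i x - M i)) + s * ∑ i, w i * (φ i x - M i) ^ 2) := by
      simp only [mul_add, Finset.mul_sum, ← Finset.sum_sub_distrib, ← Finset.sum_add_distrib]
      exact Finset.sum_congr rfl fun i _ => by ring
    have h2 : 0 ≤ s * (2 * ∑ i, w i * (M i * (φ i x - M i)) +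
        s * ∑ i, w i * (φ i x - M i) ^ 2) := by
      rw [← h1]
      exact sub_nonneg.2 h
    exact nonneg_of_mul_nonneg_right h2 hs
  have hlim : Filter.Tendsto (fun s : ℝ => 2 * ∑ i, w i * (M i * (φ i x - M i)) +
      s * ∑ i, w i * (φ i x - M i) ^ 2) (nhdsWithin 0 (Set.Ioi 0))
      (nhds (2 * ∑ i, w i * (M i * (φ i x - M i)) + 0 * ∑ i, w i * (φ i x - M i) ^ 2)) :=
    ((by fun_prop : Continuous fun s : ℝ => 2 * ∑ i, w i * (M i * (φ i x - M i)) +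
      s * ∑ i, w i * (φ i x - M i) ^ 2).tendsto 0).mono_left nhdsWithin_le_nhds
  have h0 := ge_of_tendsto hlim (by
    filter_upwards [Ioo_mem_nhdsGT (zero_lt_one' ℝ)] with s hs using hstep s hs.1 hs.2)
  rw [energy_eq_sum hf hφ, integral_kernel hf hφ, ← sub_nonneg, ← Finset.sum_sub_distrib]
  have h3 : ∑ i, w i * (M i * (φ i x - M i)) = ∑ i, (w i * φ i x * M i - w i * M i ^ 2) :=
    Finset.sum_congr rfl fun i _ => by ring
  linarith

/-- The potential minus the energy is nonnegative and has integral zero against `μ`, so it vanishes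
almost everywhere, and on the support by continuity. -/
theorem IsEnergyMinimizer.potential_eq_energy
    (hf : ∀ x y : USphere d, f (inner ℝ x.1 y.1) = ∑ i, w i * φ i x * φ i y)
    (hφ : ∀ i, Continuous (φ i)) {μ : Measure (USphere d)} (hμ : IsEnergyMinimizer f μ) :
    μ.support ⊆ {x | ∫ y : USphere d, f (inner ℝ x.1 y.1) ∂μ - energy f μ = 0} := by
  have hμp := hμ.1
  have hcont : Continuous fun x : USphere d =>
      ∫ y : USphere d, f (inner ℝ x.1 y.1) ∂μ - energy f μ := by
    simp only [integral_kernel hf hφ]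
    fun_prop
  refine Measure.support_subset_of_isClosed (isClosed_singleton.preimage hcont) ?_
  have h := (integral_eq_zero_iff_of_nonneg (μ := μ)
    (fun x => sub_nonneg.2 (hμ.energy_le_potential hf hφ x))
    (hcont.integrable_sphere μ)).1 (by
      rw [integral_sub]
      · simp [energy]
      · simp only [integral_kernel hf hφ]
        exact Continuous.integrable_sphere (by fun_prop) μ
      · exact integrable_const _)
  exact h

end EulerLagrange

/-! ### Energies of the individual ultraspherical polynomials. -/

theorem sphereGegenbauer_eval_one_pos {d : ℕ} (hd : 2 ≤ d) (n : ℕ) :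
    0 < (sphereGegenbauer d n).eval 1 := by
  rcases hd.eq_or_lt with rfl | hd
  · simp [sphereGegenbauer]
  have hd2 : d ≠ 2 := by omega
  simp only [sphereGegenbauer, hd2, if_false]
  have hl : 0 < ((d : ℝ) - 2) / 2 := by
    have : (3 : ℝ) ≤ d := by exact_mod_cast hd
    linarith
  generalize ((d : ℝ) - 2) / 2 = l at hl
  -- At `t = 1` the three-term recurrence collapses to two terms with positive coefficients.
  have hrec (n : ℕ) : (n + 1) * (gegenbauer l (n + 1)).eval 1 =
      (n + 2 * l) * (gegenbauer l n).eval 1 := by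
    induction n with
    | zero => simp [gegenbauer]
    | succ n ih =>
      have h : (n : ℝ) + 2 ≠ 0 := by positivity
      rw [gegenbauer]
      simp only [eval_mul, eval_C, eval_sub, eval_X]
      push_cast
      rw [show (n : ℝ) + 1 + 1 = n + 2 by ring, mul_inv_cancel_left₀ h]
      linear_combination ih
  induction n with
  | zero => simp [gegenbauer]
  | succ n ih =>
    have h1 : 0 < (n + 2 * l) * (gegenbauer l n).eval 1 := by positivity
    rw [← hrec n] at h1
    exact pos_of_mul_pos_right h1 (by positivity)

theorem one_mem_sphericalHarmonics_zero (d : ℕ) : (fun _ => 1) ∈ sphericalHarmonics d 0 :=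
  ⟨1, ⟨MvPolynomial.isHomogeneous_one _ _, by simp [polyLaplacian]⟩,
    by ext; simp [restrictToSphere]⟩

theorem sphereGegenbauer_zero (d : ℕ) : sphereGegenbauer d 0 = 1 := by
  simp [sphereGegenbauer, gegenbauer]

theorem integral_sphericalHarmonics {d : ℕ} (hd : 2 ≤ d) {n : ℕ} (hn : n ≠ 0) {Y : USphere d → ℝ}
    (hY : Y ∈ sphericalHarmonics d n) : ∫ x, Y x ∂uniformMeasure d = 0 := by
  simpa using integral_mul_sphericalHarmonics hd hn hY (one_mem_sphericalHarmonics_zero d)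

/-- The energy of the `n`-th ultraspherical polynomial. -/
noncomputable def gegenbauerEnergy {d : ℕ} (n : ℕ) (μ : Measure (USphere d)) : ℝ :=
  energy (fun t => (sphereGegenbauer d n).eval t) μ

section Gegenbauer

variable {d : ℕ}

theorem gegenbauerEnergy_eq_sum {n N : ℕ} {φ : Fin N → USphere d → ℝ}
    (hφ : ∀ j, φ j ∈ sphericalHarmonics d n)
    (hC : ∀ x y : USphere d, (sphereGegenbauer d n).eval (inner ℝ x.1 y.1) = ∑ j, φ j x * φ j y)
    (μ : Measure (USphere d)) [IsFiniteMeasure μ] :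
    gegenbauerEnergy n μ = ∑ j, (∫ x, φ j x ∂μ) ^ 2 := by
  rw [gegenbauerEnergy, energy_eq_sum (w := fun _ => 1) (φ := φ) (by simpa using hC)
    fun j => continuous_of_mem_sphericalHarmonics (hφ j)]
  simp

theorem gegenbauerEnergy_nonneg (hd : 2 ≤ d) (n : ℕ) (μ : Measure (USphere d))
    [IsFiniteMeasure μ] : 0 ≤ gegenbauerEnergy n μ := by
  obtain ⟨N, φ, hφ, hC⟩ := exists_addition_formula hd n
  rw [gegenbauerEnergy_eq_sum hφ hC]
  exact Finset.sum_nonneg fun j _ => sq_nonneg _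

theorem gegenbauerEnergy_zero (μ : Measure (USphere d)) [IsProbabilityMeasure μ] :
    gegenbauerEnergy 0 μ = 1 := by
  simp [gegenbauerEnergy, energy, sphereGegenbauer_zero]

theorem gegenbauerEnergy_uniformMeasure (hd : 2 ≤ d) {n : ℕ} (hn : n ≠ 0) :
    gegenbauerEnergy n (uniformMeasure d) = 0 := by
  have := isFiniteMeasure_uniformMeasure hd
  obtain ⟨N, φ, hφ, hC⟩ := exists_addition_formula hd n
  rw [gegenbauerEnergy_eq_sum hφ hC]
  exact Finset.sum_eq_zero fun j _ => by simp [integral_sphericalHarmonics hd hn (hφ j)]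

/-- A perturbation of `σ` by a spherical harmonic of order `n` has positive energy only in the
orders `0` and `n`. -/
theorem exists_gegenbauerEnergy_pos (hd : 2 ≤ d) {n : ℕ} (hn : n ≠ 0) :
    ∃ ν : Measure (USphere d), IsProbabilityMeasure ν ∧ 0 < gegenbauerEnergy n ν ∧
      ∀ k, k ≠ 0 → k ≠ n → gegenbauerEnergy k ν = 0 := by
  have hσ := isProbabilityMeasure_uniformMeasure d (by omega)
  obtain ⟨e⟩ : Nonempty (USphere d) := (uniformMeasure d).nonempty_of_neZero
  obtain ⟨N, φ, hφ, hC⟩ := exists_addition_formula hd n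
  -- By the addition formula at `x = y = e`, the squares of the `φ j e` add up to `C_n(1) > 0`.
  obtain ⟨j, hj⟩ : ∃ j, φ j e ≠ 0 := by
    by_contra! h
    have h1 := hC e e
    rw [real_inner_self_eq_norm_sq, show ‖e.1‖ = 1 by simp, one_pow] at h1
    have := sphereGegenbauer_eval_one_pos hd n
    simp [h1, h] at this
  have hYc (j) := continuous_of_mem_sphericalHarmonics (hφ j)
  -- Dividing by a bound `B` of the harmonic makes the density `1 + B⁻¹ * φ j` nonnegative.
  obtain ⟨B, hB⟩ := isCompact_univ.exists_bound_of_continuousOn (hYc j).continuousOn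
  have hB0 : 0 < B := (norm_pos_iff.2 hj).trans_le (hB e trivial)
  have hdens (x : USphere d) : 0 ≤ 1 + B⁻¹ * φ j x := by
    have h1 := (abs_le.1 (hB x trivial)).1
    have h2 : B⁻¹ * -B ≤ B⁻¹ * φ j x := by gcongr
    rw [mul_neg, inv_mul_cancel₀ hB0.ne'] at h2
    linarith
  have hcont : Continuous fun x => 1 + B⁻¹ * φ j x := by have := hYc j; fun_prop
  let ν := (uniformMeasure d).withDensity fun x => ENNReal.ofReal (1 + B⁻¹ * φ j x)
  have hint {F : USphere d → ℝ} (hF : Continuous F) : ∫ x, F x ∂ν =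
      ∫ x, F x ∂uniformMeasure d + B⁻¹ * ∫ x, φ j x * F x ∂uniformMeasure d := by
    rw [integral_withDensity_eq_integral_toReal_smul hcont.measurable.ennreal_ofReal
      (Filter.Eventually.of_forall fun x => ENNReal.ofReal_lt_top)]
    simp only [ENNReal.toReal_ofReal (hdens _), smul_eq_mul, add_mul, one_mul, mul_assoc]
    have hm : Integrable (fun x => φ j x * F x) (uniformMeasure d) :=
      ((hYc j).mul hF).integrable_sphere _
    rw [integral_add (hF.integrable_sphere _) (hm.const_mul _), integral_const_mul]
  have hν : IsProbabilityMeasure ν := by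
    refine ⟨?_⟩
    rw [withDensity_apply _ MeasurableSet.univ, Measure.restrict_univ,
      ← ofReal_integral_eq_lintegral_ofReal (hcont.integrable_sphere _)
        (Filter.Eventually.of_forall hdens), integral_add (integrable_const _)
        (((hYc j).integrable_sphere _).const_mul _), integral_const_mul,
      integral_sphericalHarmonics hd hn (hφ j)]
    simp
  refine ⟨ν, hν, ?_, fun k hk hkn => ?_⟩
  · rw [gegenbauerEnergy_eq_sum hφ hC]
    refine lt_of_lt_of_le ?_ (Finset.single_le_sum (fun i _ => sq_nonneg _) (Finset.mem_univ j))
    rw [hint (hYc j), integral_sphericalHarmonics hd hn (hφ j), zero_add]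
    have h1 : 0 < ∫ x, φ j x * φ j x ∂uniformMeasure d := by
      have : (uniformMeasure d).IsOpenPosMeasure :=
        Measure.isOpenPosMeasure_smul _ (ENNReal.inv_ne_zero.2 (measure_ne_top _ _))
      refine Continuous.integral_pos_of_hasCompactSupport_nonneg_nonzero ((hYc j).mul (hYc j))
        (HasCompactSupport.of_compactSpace _) (fun x => mul_self_nonneg _) (x := e) ?_
      exact mul_self_ne_zero.2 hj
    positivity
  · obtain ⟨N', φ', hφ', hC'⟩ := exists_addition_formula hd k
    rw [gegenbauerEnergy_eq_sum hφ' hC']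
    refine Finset.sum_eq_zero fun i _ => ?_
    rw [hint (continuous_of_mem_sphericalHarmonics (hφ' i)),
      integral_sphericalHarmonics hd hk (hφ' i),
      integral_mul_sphericalHarmonics hd (Ne.symm hkn) (hφ j) (hφ' i)]
    simp

/-- The kernel `f(⟨x, y⟩)` diagonalized by spherical harmonics. -/
theorem exists_kernel_expansion (hd : 2 ≤ d) {m : ℕ} {a : ℕ → ℝ} {f : ℝ[X]}
    (hf : f = ∑ n ∈ Finset.range (m + 1), C (a n) * sphereGegenbauer d n) :
    ∃ (N : ℕ → ℕ) (φ : (n : ℕ) → Fin (N n) → USphere d → ℝ),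
      (∀ n j, φ n j ∈ sphericalHarmonics d n) ∧
      (∀ n (x y : USphere d), (sphereGegenbauer d n).eval (inner ℝ x.1 y.1) =
        ∑ j, φ n j x * φ n j y) ∧
      ∀ x y : USphere d, f.eval (inner ℝ x.1 y.1) =
        ∑ i : (n : Fin (m + 1)) × Fin (N n), a i.1 * φ i.1 i.2 x * φ i.1 i.2 y := by
  choose N φ hφ hC using exists_addition_formula hd
  refine ⟨N, φ, hφ, hC, fun x y => ?_⟩
  rw [hf, eval_finsetSum, Fintype.sum_sigma, Finset.sum_range]
  refine Finset.sum_congr rfl fun n _ => ?_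
  simp only [eval_mul, eval_C, hC, Finset.mul_sum, mul_assoc]

theorem energy_eq_sum_gegenbauerEnergy (hd : 2 ≤ d) {m : ℕ} {a : ℕ → ℝ} {f : ℝ[X]}
    (hf : f = ∑ n ∈ Finset.range (m + 1), C (a n) * sphereGegenbauer d n)
    (μ : Measure (USphere d)) [IsProbabilityMeasure μ] :
    energy (fun t => f.eval t) μ = a 0 + ∑ n ∈ Finset.Icc 1 m, a n * gegenbauerEnergy n μ := by
  obtain ⟨N, φ, hφ, hC, hK⟩ := exists_kernel_expansion hd hf
  have h1 : energy (fun t => f.eval t) μ =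
      ∑ n ∈ Finset.range (m + 1), a n * gegenbauerEnergy n μ := by
    rw [energy_eq_sum hK fun i => continuous_of_mem_sphericalHarmonics (hφ _ _),
      Fintype.sum_sigma, Finset.sum_range]
    refine Finset.sum_congr rfl fun n _ => ?_
    simp only [gegenbauerEnergy_eq_sum (hφ n) (hC n), Finset.mul_sum]
  rw [h1, Finset.sum_range_succ', gegenbauerEnergy_zero, mul_one, add_comm,
    Finset.range_eq_Ico, Finset.sum_Ico_add' (fun n => a n * gegenbauerEnergy n μ) 0 m 1]
  rfl

end Gegenbauer

/-! ### Minimizers of the energy. -/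

section Minimizers

variable {d : ℕ} {m : ℕ} {a : ℕ → ℝ} {f : ℝ[X]}

theorem not_isEnergyMinimizer_uniformMeasure_iff (hd : 2 ≤ d)
    (hf : f = ∑ n ∈ Finset.range (m + 1), C (a n) * sphereGegenbauer d n) :
    ¬ IsEnergyMinimizer (fun t => f.eval t) (uniformMeasure d) ↔
      ∃ n ∈ Finset.Icc 1 m, a n < 0 := by
  have hσ := isProbabilityMeasure_uniformMeasure d (by omega)
  have hne {n : ℕ} (hn : n ∈ Finset.Icc 1 m) : n ≠ 0 := by
    rw [Finset.mem_Icc] at hn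
    omega
  have hEσ : energy (fun t => f.eval t) (uniformMeasure d) = a 0 := by
    rw [energy_eq_sum_gegenbauerEnergy hd hf, Finset.sum_eq_zero, add_zero]
    exact fun n hn => by rw [gegenbauerEnergy_uniformMeasure hd (hne hn), mul_zero]
  constructor
  · intro h
    by_contra! hpos
    refine h ⟨hσ, fun ν hν => ?_⟩
    rw [hEσ, energy_eq_sum_gegenbauerEnergy hd hf]
    have := Finset.sum_nonneg fun n hn =>
      mul_nonneg (hpos n hn) (gegenbauerEnergy_nonneg hd n ν)
    linarith
  · rintro ⟨n, hn, hneg⟩ h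
    obtain ⟨ν, hν, hpos, hzero⟩ := exists_gegenbauerEnergy_pos hd (hne hn)
    have h1 := h.2 ν hν
    rw [hEσ, energy_eq_sum_gegenbauerEnergy hd hf, Finset.sum_eq_single n
      (fun k hk hkn => by rw [hzero k (hne hk) hkn, mul_zero]) (fun h => absurd hn h)] at h1
    have := mul_neg_of_neg_of_pos hneg hpos
    linarith

theorem finrank_prod_pi_dual (s : Finset ℕ) : Module.finrank ℝ
    (ℝ × ((n : s) → Module.Dual ℝ (sphericalHarmonics d n))) =
      1 + ∑ n ∈ s, Module.finrank ℝ (sphericalHarmonics d n) := by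
  rw [Module.finrank_prod, Module.finrank_self, Module.finrank_pi_fintype]
  simp only [Subspace.dual_finrank_eq]
  rw [Finset.sum_coe_sort s fun n => Module.finrank ℝ (sphericalHarmonics d n)]

/-- There is a minimizer with few atoms. -/
theorem exists_isEnergyMinimizer_encard_support_le (hd : 2 ≤ d)
    (hf : f = ∑ n ∈ Finset.range (m + 1), C (a n) * sphereGegenbauer d n) :
    ∃ μ : Measure (USphere d), IsEnergyMinimizer (fun t => f.eval t) μ ∧
      μ.support.encard ≤ ((1 + ∑ n ∈ Finset.Icc 1 m with 0 < a n,
          Module.finrank ℝ (sphericalHarmonics d n) : ℕ) : ℕ∞) := by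
  obtain ⟨N, φ, hφ, hC, hK⟩ := exists_kernel_expansion hd hf
  have hcont (i : (n : Fin (m + 1)) × Fin (N n)) : Continuous (φ i.1 i.2) :=
    continuous_of_mem_sphericalHarmonics (hφ _ _)
  obtain ⟨A, _, x, p, hp, hp1, hmin⟩ :=
    exists_isEnergyMinimizer_pointMeasure (f := fun t => f.eval t) (by omega) hK hcont
  let s := (Finset.Icc 1 m).filter (0 < a ·)
  -- `L` records the mass and the evaluation functional on each order with positive coefficient, so
  -- its target has exactly the dimension claimed as a bound. Dual spaces are used because the
  -- number `N n` of functions in the expansion is not compared with the dimension of the harmonics.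
  let L (y : USphere d) : ℝ × ((n : s) → Module.Dual ℝ (sphericalHarmonics d n)) :=
    (1, fun n => (LinearMap.proj y).comp (sphericalHarmonics d n).subtype)
  have hL {B : Type} [Fintype B] (z : B → USphere d) (t : B → ℝ) (ht : ∑ b, t b • L (z b) = 0) :
      ∑ b, t b = 0 ∧ pointEnergy (fun i : (n : Fin (m + 1)) × Fin (N n) => a i.1)
        (fun i => φ i.1 i.2) z t ≤ 0 := by
    have h1 : ∑ b, t b = 0 := by
      simpa [L, Prod.fst_sum] using congrArg Prod.fst ht
    have h2 (n : ℕ) (hn : n ∈ s) (j : Fin (N n)) : ∑ b, t b * φ n j (z b) = 0 := by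
      have h3 := congrArg (fun v => v.2 ⟨n, hn⟩ ⟨φ n j, hφ n j⟩) ht
      simpa [L, Prod.snd_sum, Finset.sum_apply, LinearMap.sum_apply] using h3
    -- The order 0 part of the kernel is the constant 1, so zero mass kills it whatever the sign of
    -- `a 0`.
    have h0 : ∑ j, (∑ b, t b * φ 0 j (z b)) ^ 2 = 0 := by
      have h3 : ∑ j, (∑ b, t b * φ 0 j (z b)) ^ 2 = ∑ b, ∑ c, t b * t c * 1 := by
        simp only [sq, Finset.sum_mul_sum]
        rw [Finset.sum_comm]
        refine Finset.sum_congr rfl fun b _ => ?_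
        rw [Finset.sum_comm]
        refine Finset.sum_congr rfl fun c _ => ?_
        have h4 := hC 0 (z b) (z c)
        rw [sphereGegenbauer_zero, eval_one] at h4
        rw [h4, Finset.mul_sum]
        exact Finset.sum_congr rfl fun j _ => by ring
      simp only [h3, mul_one, ← Finset.mul_sum, h1, mul_zero, Finset.sum_const_zero]
    refine ⟨h1, ?_⟩
    rw [pointEnergy, Fintype.sum_sigma]
    refine Finset.sum_nonpos fun n _ => ?_
    simp only [← Finset.mul_sum]
    by_cases hn0 : (n : ℕ) = 0
    · obtain rfl : n = 0 := Fin.ext hn0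
      exact (mul_eq_zero_of_right _ h0).le
    rcases lt_or_ge 0 (a n) with hpos | hneg
    · have hn : (n : ℕ) ∈ s := by
        simp only [s, Finset.mem_filter, Finset.mem_Icc]
        exact ⟨⟨by omega, by omega⟩, hpos⟩
      simp [h2 n hn]
    · exact mul_nonpos_of_nonpos_of_nonneg hneg (Finset.sum_nonneg fun j _ => sq_nonneg _)
  obtain ⟨B, _, y, r, hcard, hr, hr1, hE⟩ :=
    exists_pointEnergy_le_card_le_finrank hL _ le_rfl x hp
  rw [finrank_prod_pi_dual] at hcard
  have hr0 (b) : 0 ≤ r b := (hr b).le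
  rw [hp1] at hr1
  refine ⟨pointMeasure y r, ⟨isProbabilityMeasure_pointMeasure y hr0 hr1, fun ν hν => ?_⟩,
    (encard_support_pointMeasure_le y r).trans (by exact_mod_cast hcard)⟩
  refine le_trans ?_ (hmin.2 ν hν)
  rw [energy_pointMeasure hK hcont y hr0 hr1,
    energy_pointMeasure hK hcont x (fun b => (hp b).le) hp1]
  exact hE

/-- The support of a minimizer lies in the zero set of a polynomial that does not vanish identically
on the sphere, unless `σ` is a minimizer. -/
theorem exists_support_subset_zeros (hd : 2 ≤ d)
    (hf : f = ∑ n ∈ Finset.range (m + 1), C (a n) * sphereGegenbauer d n)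
    (hσmin : ¬ IsEnergyMinimizer (fun t => f.eval t) (uniformMeasure d)) {μ : Measure (USphere d)}
    (hμ : IsEnergyMinimizer (fun t => f.eval t) μ) :
    ∃ q : MvPolynomial (Fin d) ℝ, μ.support ⊆ {x | restrictToSphere d q x = 0} ∧
      ∃ x, restrictToSphere d q x ≠ 0 := by
  have hσ := isProbabilityMeasure_uniformMeasure d (by omega)
  have hμp := hμ.1
  obtain ⟨N, φ, hφ, hC, hK⟩ := exists_kernel_expansion hd hf
  have hcont (i : (n : Fin (m + 1)) × Fin (N n)) : Continuous (φ i.1 i.2) :=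
    continuous_of_mem_sphericalHarmonics (hφ _ _)
  have hsupp := hμ.potential_eq_energy hK hcont
  -- The polynomial is the potential of `μ` minus its energy, a combination of spherical harmonics.
  obtain ⟨q, hq⟩ : (fun x : USphere d => ∫ y : USphere d, f.eval (inner ℝ x.1 y.1) ∂μ -
      energy (fun t => f.eval t) μ) ∈ LinearMap.range (restrictToSphere d) := by
    have h1 : (fun x : USphere d => ∫ y : USphere d, f.eval (inner ℝ x.1 y.1) ∂μ -
        energy (fun t => f.eval t) μ) =
        ∑ i : (n : Fin (m + 1)) × Fin (N n), (a i.1 * ∫ y, φ i.1 i.2 y ∂μ) • φ i.1 i.2 -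
          energy (fun t => f.eval t) μ • fun _ => 1 := by
      ext x
      rw [integral_kernel (f := fun t => f.eval t) hK hcont]
      simp only [Pi.sub_apply, Finset.sum_apply, Pi.smul_apply, smul_eq_mul, mul_one]
      congr 1
      exact Finset.sum_congr rfl fun i _ => by ring
    have hmem {n : ℕ} {Y : USphere d → ℝ} (hY : Y ∈ sphericalHarmonics d n) :
        Y ∈ LinearMap.range (restrictToSphere d) := LinearMap.map_le_range hY
    rw [h1]
    exact Submodule.sub_mem _ (Submodule.sum_mem _ fun i _ => Submodule.smul_mem _ _
      (hmem (hφ _ _))) (Submodule.smul_mem _ _ (hmem (one_mem_sphericalHarmonics_zero d)))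
  refine ⟨q, by rw [hq]; exact hsupp, ?_⟩
  by_contra! h
  rw [hq] at h
  -- The moments of `σ` of positive order vanish, so only order 0 contributes to the mutual energy
  -- of `σ` and `μ`, and there the kernel is constant.
  have hσcross : ∫ x : USphere d, ∫ y : USphere d, f.eval (inner ℝ x.1 y.1) ∂μ ∂uniformMeasure d =
      energy (fun t => f.eval t) (uniformMeasure d) := by
    rw [energy_eq_sum hK hcont,
      integral_integral_kernel (f := fun t => f.eval t) hK hcont (uniformMeasure d) μ,
      Fintype.sum_sigma, Fintype.sum_sigma]
    refine Finset.sum_congr rfl fun n _ => ?_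
    rcases eq_or_ne n 0 with rfl | hn
    · have h0 (ν : Measure (USphere d)) [IsProbabilityMeasure ν] :
          ∑ j, 1 * (∫ x, φ 0 j x ∂uniformMeasure d) * ∫ y, φ 0 j y ∂ν = 1 := by
        rw [← integral_integral_kernel (f := fun t => (sphereGegenbauer d 0).eval t)
          (by simpa using hC 0) (fun j => continuous_of_mem_sphericalHarmonics (hφ 0 j))]
        simp [sphereGegenbauer_zero]
      have h1 := (h0 μ).trans (h0 (uniformMeasure d)).symm
      simp only [one_mul] at h1
      simp only [mul_assoc, sq, ← Finset.mul_sum]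
      exact congrArg (a 0 * ·) h1
    · have hn' : (n : ℕ) ≠ 0 := fun h => hn (Fin.ext h)
      simp [integral_sphericalHarmonics hd hn' (hφ n _)]
  -- If the potential were identically the energy of `μ`, the mutual energy would equal it too, and
  -- `σ` would have the minimal energy.
  refine hσmin ⟨hσ, fun ν hν => ?_⟩
  rw [← hσcross]
  refine le_trans (le_of_eq ?_) (hμ.2 ν hν)
  simp only [sub_eq_zero] at h
  simp [h]

end Minimizers

theorem corollary6p1 (d : ℕ) (hd : 2 ≤ d) (m : ℕ) (a : ℕ → ℝ) (f : Polynomial ℝ)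
    (hf : f = ∑ n ∈ Finset.range (m + 1), Polynomial.C (a n) * sphereGegenbauer d n) :
    (∃ μ : Measure (USphere d), IsEnergyMinimizer (fun t => f.eval t) μ ∧
      μ.support.encard ≤
        ((1 + ∑ n ∈ Finset.Icc 1 m with 0 < a n,
          Module.finrank ℝ (sphericalHarmonics d n) : ℕ) : ℕ∞)) ∧
    ((¬ IsEnergyMinimizer (fun t => f.eval t) (uniformMeasure d)) ↔
      ∃ n ∈ Finset.Icc 1 m, a n < 0) ∧
    ((∃ n ∈ Finset.Icc 1 m, a n < 0) →
      ∀ μ : Measure (USphere d), IsEnergyMinimizer (fun t => f.eval t) μ →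
        interior μ.support = ∅ ∧ (d = 2 → μ.support.Finite)) := by
  refine ⟨exists_isEnergyMinimizer_encard_support_le hd hf,
    not_isEnergyMinimizer_uniformMeasure_iff hd hf, fun hneg μ hμ => ?_⟩
  obtain ⟨q, hsub, x, hx⟩ := exists_support_subset_zeros hd hf
    ((not_isEnergyMinimizer_uniformMeasure_iff hd hf).2 hneg) hμ
  constructor
  · by_contra hne
    exact hx (restrictToSphere_eq_zero_of_interior hd
      ((Set.nonempty_iff_ne_empty.2 hne).mono (interior_mono hsub)) x)
  · rintro rfl
    by_contra hinf
    exact hx (restrictToSphere_eq_zero_of_infinite (Set.Infinite.mono hsub hinf) x)
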